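/- Let $N$ be an odd squarefree positive integer, let $p$ be a prime dividing $N$, and let $$\mathcal V_p=\{x\in M_2(\mathbb Q_p):\operatorname{tr}x=0\},\qquad Q(x)=N\det x,\qquad \mathcal L=\mathcal L_p=\left\{\begin{pmatrix} a& b/N\\ c&-a\end{pmatrix}: a,b,c\in\mathbb Z_p\right\}\subset\mathcal V_p .$$ For vectors $x_1,x_2$ in a quadratic space over $\mathbb Q_p$ let $T(x_1,x_2)=\big(\tfrac12\langle x_i,x_j\rangle\big)_{i,j}$, where $\langle x,y\rangle=Q(x+y)-Q(x)-Q(y)$. A matrix $T$ is represented by the space if $T=T(x_1,x_2)$ for some $x_1,x_2$ in it. For $T\in\mathrm{Sym}_2(\mathbb Z_p)$ let $\alpha_p(X,T,\mathcal L)$ denote the local representation density polynomial: the (unique) polynomial in $X$ whose value at $X=p^{-r}$ is, for every integer $r\ge 0$, $$\lim_{k\to\infty}p^{k(3-2(3+2r))}\,\#\{x\in (L_r/p^kL_r)^2: T(x)\equiv T \bmod p^k\},\qquad L_r=\mathcal L\oplus H^r,$$ where $H=\mathbb Z_p^2$ is the hyperbolic plane with $Q(u,v)=uv$. The Gross–Keating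 invariants of $B\in \mathrm{Sym}_3(\mathbb Z_p)$ are the lexicographically greatest sequence of integers $0\le y_1\le y_2\le y_3$ such that, for some $U\in \mathrm{GL}_3(\mathbb Z_p)$, the coefficients $b_{ij}$ $(i\le j)$ of the quadratic form $x\mapsto{}^tx\,({}^tUBU)\,x=\sum_{i\le j}b_{ij}x_ix_j$ satisfy $\operatorname{ord}_p(b_{ij})\ge (y_i+y_j)/2$ for all $i\le j$. Let $0\le a_1\le a_2\le a_3$ be the Gross–Keating invariants of $\mathrm{diag}(N,T)$, and let $\nu_p(T)$ be the Gross–Keating intersection number, given explicitly as follows. If $a_1\equiv a_2\pmod 2$, then $$\nu_p(T)=\sum_{i=0}^{a_1-1}(i+1)(a_1+a_2+a_3-3i)p^i+\sum_{i=a_1}^{(a_1+a_2-2)/2}(a_1+1)(2a_1+a_2+a_3-4i)p^i+\frac{a_1+1}{2}(a_3-a_2+1)p^{(a_1+a_2)/2},$$ and if $a_1\not\equiv a_2\pmod 2$, then $$\nu_p(T)=\sum_{i=0}^{a_1-1}(i+1)(a_1+a_2+a_3-3i)p^i+\sum_{i=a_1}^{(a_1+a_2-1)/2}(a_1+1)(2a_1+a_2+a_3-4i)p^i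 .$$ **Proposition.** Let $T\in\mathrm{Sym}_2(\mathbb Z_p)$, and suppose that $T$ is not represented by $\mathcal V_p$. Then the polynomial $\alpha_p(X,T,\mathcal L)$ and the Gross–Keating invariants of $\mathrm{diag}(N,T)$ exist, and $$\frac{p}{1-p}\,\alpha_p'(1,T,\mathcal L)=\nu_p(T),$$ where $\alpha_p'(1,T,\mathcal L)=\frac{d}{dX}\alpha_p(X,T,\mathcal L)\big|_{X=1}$. -/

import Mathlib

open Polynomial Filter Topology

noncomputable section

namespace LocalDensity

/-! ### Moment matrices, representability and representation densities -/

section Density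

variable {p : ℕ} [Fact p.Prime] {V : Type*} [AddCommGroup V] [Module ℚ_[p] V]

/-- The moment matrix `T(x) = (½ ⟨x i, x j⟩)`, where `⟨x, y⟩ = Q(x + y) - Q(x) - Q(y)`. -/
def momentMatrix (Q : QuadraticForm ℚ_[p] V) {n : ℕ} (x : Fin n → V) :
    Matrix (Fin n) (Fin n) ℚ_[p] :=
  Matrix.of fun i j => (1 / 2 : ℚ_[p]) * QuadraticMap.polar Q (x i) (x j)

/-- The quadratic space `(V, Q)` over `ℚ_p` represents the matrix `T`. -/
def Represents (Q : QuadraticForm ℚ_[p] V) {n : ℕ} (T : Matrix (Fin n) (Fin n) ℚ_[p]) : Prop :=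
  ∃ x : Fin n → V, momentMatrix Q x = T

variable [Module ℤ_[p] V] [IsScalarTower ℤ_[p] ℚ_[p] V]

/-- The set of `x ∈ (L / p ^ k L) ^ n` with `T(x) ≡ T mod p ^ k`. For an odd prime `p` and a lattice
`L` on which `Q` takes values in `ℤ_p`, the congruence does not depend on the choice of the lift `y`
of `x` to `L ^ n`. -/
def repSet (Q : QuadraticForm ℚ_[p] V) (L : Submodule ℤ_[p] V) {n : ℕ}
    (T : Matrix (Fin n) (Fin n) ℤ_[p]) (k : ℕ) :
    Set (Fin n → L ⧸ (Ideal.span {(p : ℤ_[p]) ^ k} • (⊤ : Submodule ℤ_[p] L))) :=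
  {x | ∃ y : Fin n → L, (∀ i, Submodule.Quotient.mk (y i) = x i) ∧
    ∀ i j, ∃ z : ℤ_[p],
      momentMatrix Q (fun l => (y l : V)) i j - (T i j : ℚ_[p]) = (p : ℚ_[p]) ^ k * (z : ℚ_[p])}

/-- `α` is the (classical, Siegel) representation density of `T` by the lattice `L` of rank
`m = dim V`, i.e. `α = lim_k p ^ {k (n (n + 1) / 2 - m n)} #{x ∈ (L / p ^ k L) ^ n : T(x) ≡ T mod p ^ k}`. -/
def IsRepDensity (Q : QuadraticForm ℚ_[p] V) (L : Submodule ℤ_[p] V) {n : ℕ}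
    (T : Matrix (Fin n) (Fin n) ℤ_[p]) (α : ℝ) : Prop :=
  Tendsto (fun k : ℕ => ((repSet Q L T k).ncard : ℝ) * ((p : ℝ) ^ k) ^ (n * (n + 1) / 2) /
    ((p : ℝ) ^ k) ^ (Module.finrank ℚ_[p] V * n)) atTop (𝓝 α)

variable (p) in
/-- The quadratic form `Q(u, v) = ∑ u i * v i` on `ℚ_p ^ r × ℚ_p ^ r`: the orthogonal sum of
`r` hyperbolic planes. -/
def hyperbolicForm (r : ℕ) : QuadraticForm ℚ_[p] ((Fin r → ℚ_[p]) × (Fin r → ℚ_[p])) :=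
  ∑ i : Fin r, QuadraticMap.linMulLin
    ((LinearMap.proj i : (Fin r → ℚ_[p]) →ₗ[ℚ_[p]] ℚ_[p]) ∘ₗ LinearMap.fst ℚ_[p] _ _)
    ((LinearMap.proj i : (Fin r → ℚ_[p]) →ₗ[ℚ_[p]] ℚ_[p]) ∘ₗ LinearMap.snd ℚ_[p] _ _)

theorem hyperbolicForm_apply (r : ℕ) (w : (Fin r → ℚ_[p]) × (Fin r → ℚ_[p])) :
    hyperbolicForm p r w = ∑ i, w.1 i * w.2 i := by
  simp [hyperbolicForm]

variable (p) in
/-- The vectors of `ℚ_p ^ r` with integral coordinates. -/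
def integralVectors (r : ℕ) : Submodule ℤ_[p] (Fin r → ℚ_[p]) where
  carrier := {u | ∀ i, ‖u i‖ ≤ 1}
  add_mem' := fun {u v} hu hv i =>
    (Padic.nonarchimedean (u i) (v i)).trans (max_le (hu i) (hv i))
  zero_mem' := fun i => by simp
  smul_mem' := fun c u hu i => by
    have h : (c • u) i = (c : ℚ_[p]) * u i := rfl
    rw [h, norm_mul]
    exact mul_le_one₀ c.2 (norm_nonneg _) (hu i)

variable (p) in
/-- The lattice `H ^ r`, an orthogonal sum of `r` integral hyperbolic planes. -/
def hyperbolicLattice (r : ℕ) : Submodule ℤ_[p] ((Fin r → ℚ_[p]) × (Fin r → ℚ_[p])) :=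
  (integralVectors p r).prod (integralVectors p r)

/-- `P` is the local representation density polynomial `α_p(X, T, L)`: for every `r ≥ 0`, its value
at `X = p ^ {-r}` is the representation density of `T` by `L ⊕ H ^ r`. -/
def IsRepDensityPolynomial (Q : QuadraticForm ℚ_[p] V) (L : Submodule ℤ_[p] V) {n : ℕ}
    (T : Matrix (Fin n) (Fin n) ℤ_[p]) (P : ℝ[X]) : Prop :=
  ∀ r : ℕ, IsRepDensity (Q.prod (hyperbolicForm p r)) (L.prod (hyperbolicLattice p r)) T
    (P.eval (((p : ℝ)⁻¹) ^ r))

/-- The representation density polynomial is unique. -/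
theorem IsRepDensityPolynomial.unique {Q : QuadraticForm ℚ_[p] V} {L : Submodule ℤ_[p] V} {n : ℕ}
    {T : Matrix (Fin n) (Fin n) ℤ_[p]} {P P' : ℝ[X]} (h : IsRepDensityPolynomial Q L T P)
    (h' : IsRepDensityPolynomial Q L T P') : P = P' := by
  have hp : 1 < (p : ℝ) := by exact_mod_cast (Fact.out : p.Prime).one_lt
  refine Polynomial.eq_of_infinite_eval_eq P P' ?_
  have hinj : Function.Injective fun r : ℕ => ((p : ℝ)⁻¹) ^ r :=
    pow_right_injective₀ (by positivity) (inv_lt_one_of_one_lt₀ hp).ne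
  refine (Set.infinite_range_of_injective hinj).mono ?_
  rintro _ ⟨r, rfl⟩
  exact tendsto_nhds_unique (h r) (h' r)

end Density

/-! ### The quadratic space of traceless matrices and its lattice of level `N` -/

section Level

/-- The determinant as a quadratic form on `2 × 2` matrices. -/
def detForm (K : Type*) [Field K] : QuadraticForm K (Matrix (Fin 2) (Fin 2) K) :=
  QuadraticMap.linMulLin (Matrix.entryLinearMap K K 0 0) (Matrix.entryLinearMap K K 1 1) -
    QuadraticMap.linMulLin (Matrix.entryLinearMap K K 0 1) (Matrix.entryLinearMap K K 1 0)

theorem detForm_apply {K : Type*} [Field K] (x : Matrix (Fin 2) (Fin 2) K) :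
    detForm K x = x.det := by
  simp [detForm, Matrix.det_fin_two]

variable (p : ℕ) [Fact p.Prime]

/-- `M₂(ℚ_p)^{tr = 0}`. -/
abbrev Traceless : Submodule ℚ_[p] (Matrix (Fin 2) (Fin 2) ℚ_[p]) :=
  LinearMap.ker (Matrix.traceLinearMap (Fin 2) ℚ_[p] ℚ_[p])

/-- The quadratic form `Q(x) = N det x` on `M₂(ℚ_p)^{tr = 0}`. -/
def levelForm (N : ℕ) : QuadraticForm ℚ_[p] (Traceless p) :=
  (N : ℚ_[p]) • (detForm ℚ_[p]).comp (Traceless p).subtype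

theorem levelForm_apply (N : ℕ) (x : Traceless p) :
    levelForm p N x = (N : ℚ_[p]) * (x : Matrix (Fin 2) (Fin 2) ℚ_[p]).det := by
  simp [levelForm, detForm_apply]

/-- The lattice of all matrices `(a, b / N; c, -a)` with `a, b, c ∈ ℤ_p`. -/
def levelLattice (N : ℕ) : Submodule ℤ_[p] (Traceless p) where
  carrier := {x | ∃ a b c : ℤ_[p], (x : Matrix (Fin 2) (Fin 2) ℚ_[p]) =
    !![(a : ℚ_[p]), (b : ℚ_[p]) / (N : ℚ_[p]); (c : ℚ_[p]), -(a : ℚ_[p])]}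
  add_mem' := by
    rintro x y ⟨a, b, c, hx⟩ ⟨a', b', c', hy⟩
    refine ⟨a + a', b + b', c + c', ?_⟩
    rw [Submodule.coe_add, hx, hy]
    ext i j
    fin_cases i <;> fin_cases j <;> simp <;> ring
  zero_mem' := by
    refine ⟨0, 0, 0, ?_⟩
    ext i j
    fin_cases i <;> fin_cases j <;> simp
  smul_mem' := by
    rintro r x ⟨a, b, c, hx⟩
    refine ⟨r * a, r * b, r * c, ?_⟩
    have h : ((r • x : Traceless p) : Matrix (Fin 2) (Fin 2) ℚ_[p]) =
      (r : ℚ_[p]) • (x : Matrix (Fin 2) (Fin 2) ℚ_[p]) := rfl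
    rw [h, hx]
    ext i j
    fin_cases i <;> fin_cases j <;> simp <;> ring

end Level

/-! ### Gross–Keating invariants and the intersection number -/

section GrossKeating

variable {p : ℕ} [Fact p.Prime]

/-- The coefficients of the quadratic form `x ↦ xᵗ B x = ∑_{i ≤ j} b_ij x_i x_j` of a symmetric
matrix `B`. -/
def formCoeff {n : ℕ} (B : Matrix (Fin n) (Fin n) ℤ_[p]) (i j : Fin n) : ℤ_[p] :=
  if i = j then B i i else 2 * B i j

/-- The set of all sequences `0 ≤ y_1 ≤ ... ≤ y_n` such that, in some `ℤ_p`-basis,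
`ord (b_ij) ≥ (y_i + y_j) / 2` for all `i ≤ j`, where `b_ij` are the coefficients of the form. -/
def grossKeatingSet {n : ℕ} (B : Matrix (Fin n) (Fin n) ℤ_[p]) : Set (Lex (Fin n → ℕ)) :=
  {y | Monotone (ofLex y) ∧ ∃ U : Matrix (Fin n) (Fin n) ℤ_[p], IsUnit U.det ∧
    ∀ i j, i ≤ j →
      (p : ℤ_[p]) ^ (ofLex y i + ofLex y j) ∣ formCoeff (U.transpose * B * U) i j ^ 2}

/-- `a` is the sequence of Gross–Keating invariants of `B`: the greatest element of
`grossKeatingSet B` in the lexicographic order. -/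
def IsGrossKeating {n : ℕ} (B : Matrix (Fin n) (Fin n) ℤ_[p]) (a : Fin n → ℕ) : Prop :=
  IsGreatest (grossKeatingSet B) (toLex a)

/-- The Gross–Keating invariants are unique. -/
theorem IsGrossKeating.unique {n : ℕ} {B : Matrix (Fin n) (Fin n) ℤ_[p]} {a a' : Fin n → ℕ}
    (h : IsGrossKeating B a) (h' : IsGrossKeating B a') : a = a' :=
  toLex.injective (IsGreatest.unique h h')

/-- The symmetric matrix `diag(N, T)`. -/
def diagBlock (N : ℕ) (T : Matrix (Fin 2) (Fin 2) ℤ_[p]) : Matrix (Fin 3) (Fin 3) ℤ_[p] :=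
  !![(N : ℤ_[p]), 0, 0; 0, T 0 0, T 0 1; 0, T 1 0, T 1 1]

/-- The Gross–Keating intersection number attached to the invariants `a₁ ≤ a₂ ≤ a₃`. In the second
sum, the index runs up to `(a₁ + a₂ - 2) / 2` in the first case, and up to `(a₁ + a₂ - 1) / 2` in the
second case. -/
def grossKeatingNumber (p a₁ a₂ a₃ : ℕ) : ℝ :=
  if a₁ ≡ a₂ [MOD 2] then
    ∑ i ∈ Finset.range a₁, ((i : ℝ) + 1) * ((a₁ : ℝ) + a₂ + a₃ - 3 * i) * (p : ℝ) ^ i +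
    ∑ i ∈ Finset.Ico a₁ ((a₁ + a₂) / 2),
      ((a₁ : ℝ) + 1) * (2 * (a₁ : ℝ) + a₂ + a₃ - 4 * i) * (p : ℝ) ^ i +
    ((a₁ : ℝ) + 1) / 2 * ((a₃ : ℝ) - a₂ + 1) * (p : ℝ) ^ ((a₁ + a₂) / 2)
  else
    ∑ i ∈ Finset.range a₁, ((i : ℝ) + 1) * ((a₁ : ℝ) + a₂ + a₃ - 3 * i) * (p : ℝ) ^ i +
    ∑ i ∈ Finset.Ico a₁ ((a₁ + a₂ + 1) / 2),
      ((a₁ : ℝ) + 1) * (2 * (a₁ : ℝ) + a₂ + a₃ - 4 * i) * (p : ℝ) ^ i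

end GrossKeating

end LocalDensity

end

namespace LocalDensity

/-! ### Units and squares in `ℤ_p`. -/

section Padic

variable {p : ℕ} [Fact p.Prime]

/-! In suitable coordinates the lattice `L ⊕ H ^ r` carries the form `-N a² + u ⬝ v`, with `u, v` of
length `m = r + 1`. As `p` is odd, `T` may be replaced by `diag(t₁, t₂)` with orders `a ≤ b`. If
`diag(N, t₁, t₂)` had a nontrivial zero, `T` would be represented by the traceless matrices
(`represents_of_isotropic`). So this ternary form is anisotropic, and by `Anisotropic.dvd` a power
of `p` dividing a value divides each of its three terms.

The density is computed by direct counting. For a pair of vectors with moment matrix `diag(t₁, t₂)`,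
fix the halves `v₁, v₂`; the equations are then linear in `u₁, u₂`. The pairs `(v₁, v₂)` are sorted
by a Hermite normal form into cells, with elementary divisors `p ^ i, p ^ j` and a slope `s`. Over a
cell the linear system is solvable exactly under some divisibility conditions (`dens_fiber_cell`).
Anisotropy splits these into conditions on `t₁, t₂`, which select finitely many cells, and
conditions on the coordinates `a₁, a₂`, which have an explicit density (`dvd_conditions`). With `X =
p ^ (1 - m) = p ^ (-r)`, each selected cell contributes `(1 - X)(1 - X / p) X ^ (i + j)` times the
weight `p ^ (i - ⌊i/2⌋ - ⌊j/2⌋)`, so the density is a polynomial in `X` (`dens_solutions`).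

The factor `1 - X` vanishes at `X = 1`, so the derivative there is `-(1 - 1 / p)` times the sum of
all weights, and the normalisation `p / (1 - p)` leaves exactly that sum. Counting slopes and
summing geometric series identifies it with the Gross–Keating number
(`totalWeight_eq_grossKeatingNumber`). The invariants of `diag(N, T)` are `1, a, b` in increasing
order (`isGrossKeating_of_diagonal`), and anisotropy rules out that `a` and `b` are both odd
(`Anisotropic.not_odd`). -/

theorem not_isUnit_iff_dvd (x : ℤ_[p]) : ¬ IsUnit x ↔ (p : ℤ_[p]) ∣ x := by
  rw [PadicInt.not_isUnit_iff, PadicInt.norm_lt_one_iff_dvd]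

theorem isUnit_two (hp : p ≠ 2) : IsUnit (2 : ℤ_[p]) := by
  by_contra h
  rw [not_isUnit_iff_dvd] at h
  have h1 := (PadicInt.pow_p_dvd_int_iff (p := p) 1 2).1 (by simpa using h)
  have h2 : p ∣ 2 := by exact_mod_cast (by simpa using h1 : (p : ℤ) ∣ 2)
  exact hp ((Nat.prime_dvd_prime_iff_eq Fact.out Nat.prime_two).1 h2)

/-- For odd `p`, the principal units of `ℤ_p` are squares. -/
theorem exists_sq_eq_one_add (hp : p ≠ 2) (z : ℤ_[p]) : ∃ w : ℤ_[p], w ^ 2 = 1 + p * z := by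
  have h2 : ‖(2 : ℤ_[p])‖ = 1 := PadicInt.isUnit_iff.1 (isUnit_two hp)
  have hz : ‖(p : ℤ_[p]) * z‖ < 1 := (PadicInt.norm_lt_one_iff_dvd _).2 (Dvd.intro _ rfl)
  obtain ⟨w, hw, -⟩ := hensels_lemma (p := p) (F := (X ^ 2 - C (1 + (p : ℤ_[p]) * z) : ℤ_[p][X]))
    (a := 1) (by
      simp only [map_sub, map_pow, aeval_X, one_pow, aeval_C, derivative_X_pow]
      simpa [h2] using hz)
  refine ⟨w, ?_⟩
  have := hw
  simp only [map_sub, map_pow, aeval_X, aeval_C] at this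
  simpa using sub_eq_zero.1 this

end Padic

/-! ### Representability and anisotropic ternary forms. -/

section Anisotropic

variable {p : ℕ} [Fact p.Prime]

/-- A symmetric matrix `T` with `T[n] + N x² = 0` for some `n ≠ 0` is represented by the
space of traceless matrices. -/
theorem represents_of_isotropic {N : ℕ} (hN : (N : ℚ_[p]) ≠ 0) {T : Matrix (Fin 2) (Fin 2) ℚ_[p]}
    (hT : T.IsSymm) {n₁ n₂ x : ℚ_[p]} (hn : n₁ ≠ 0 ∨ n₂ ≠ 0)
    (h : T 0 0 * n₁ ^ 2 + 2 * T 0 1 * n₁ * n₂ + T 1 1 * n₂ ^ 2 + N * x ^ 2 = 0) :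
    Represents (levelForm p N) T := by
  have h10 : T 1 0 = T 0 1 := hT.apply 0 1
  -- With `a ⬝ n = x`, the binary form `T + N a aᵗ` vanishes at `n`.
  obtain ⟨a₁, a₂, ha⟩ : ∃ a₁ a₂ : ℚ_[p], a₁ * n₁ + a₂ * n₂ = x := by
    rcases hn with hn | hn
    · exact ⟨x / n₁, 0, by field_simp; ring⟩
    · exact ⟨0, x / n₂, by field_simp; ring⟩
  subst ha
  -- A binary form with zero `n` factors as `(n₂ X - n₁ Y)(β₁ X + β₂ Y)`. The two linear factors
  -- provide the off-diagonal entries of the representing matrices, the first one divided by `-N`.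
  obtain ⟨β₁, β₂, h1, h2, h3⟩ : ∃ β₁ β₂ : ℚ_[p], T 0 0 + N * a₁ ^ 2 = n₂ * β₁ ∧
      T 1 1 + N * a₂ ^ 2 = - n₁ * β₂ ∧ 2 * (T 0 1 + N * a₁ * a₂) = n₂ * β₂ - n₁ * β₁ := by
    by_cases h1 : n₁ = 0
    · subst h1
      have h2 : n₂ ≠ 0 := by simpa using hn
      refine ⟨(T 0 0 + N * a₁ ^ 2) / n₂, 2 * (T 0 1 + N * a₁ * a₂) / n₂, by field_simp, ?_,
        by field_simp; ring⟩
      have : n₂ ^ 2 * (T 1 1 + N * a₂ ^ 2) = 0 := by linear_combination h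
      simpa [h2] using this
    · refine ⟨(n₂ * (-(T 1 1 + N * a₂ ^ 2) / n₁) - 2 * (T 0 1 + N * a₁ * a₂)) / n₁,
        -(T 1 1 + N * a₂ ^ 2) / n₁, ?_, by field_simp, by field_simp; ring⟩
      field_simp
      linear_combination h
  let M : Fin 2 → Traceless p := fun i => ⟨!![![a₁, a₂] i, -(![n₂, -n₁] i) / N; ![β₁, β₂] i,
    -(![a₁, a₂] i)], by simp [Matrix.trace_fin_two]⟩
  refine ⟨M, ?_⟩
  have h22 : (2 : ℚ_[p]) ≠ 0 := two_ne_zero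
  ext i j
  fin_cases i <;> fin_cases j <;>
    simp only [momentMatrix, QuadraticMap.polar, levelForm_apply, M, Matrix.of_apply,
      Submodule.coe_add, Matrix.det_fin_two] <;> simp <;> field_simp
  · linear_combination -2 * h1
  · linear_combination -h3
  · rw [h10]; linear_combination -h3
  · linear_combination -2 * h2

/-- The form `c x² + t₁ y² + t₂ z²` over `ℤ_p` is anisotropic. -/
def Anisotropic (c t₁ t₂ : ℤ_[p]) : Prop :=
  ∀ x y z : ℤ_[p], c * x ^ 2 + t₁ * y ^ 2 + t₂ * z ^ 2 = 0 → x = 0 ∧ y = 0 ∧ z = 0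

theorem Anisotropic.swap {c t₁ t₂ : ℤ_[p]} (h : Anisotropic c t₁ t₂) : Anisotropic c t₂ t₁ :=
  fun x y z e => by
    obtain ⟨h1, h2, h3⟩ := h x z y (by linear_combination e)
    exact ⟨h1, h3, h2⟩

theorem Anisotropic.rotate {c t₁ t₂ : ℤ_[p]} (h : Anisotropic c t₁ t₂) : Anisotropic t₁ t₂ c :=
  fun x y z e => by
    obtain ⟨h1, h2, h3⟩ := h z x y (by linear_combination e)
    exact ⟨h2, h3, h1⟩

/-- If the value were divisible by a higher power of `p` than `c x²`, it would equal `c x²` times a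
multiple of `p`. Subtracting it multiplies `c x²` by a principal unit, which is a square `w²`, so
`(x w, y, z)` would be a nontrivial zero. -/
theorem Anisotropic.dvd_of_dvd_terms (hp : p ≠ 2) {c t₁ t₂ : ℤ_[p]} (h : Anisotropic c t₁ t₂)
    {e : ℕ} {x y z : ℤ_[p]} (hd : (p : ℤ_[p]) ^ e ∣ c * x ^ 2 + t₁ * y ^ 2 + t₂ * z ^ 2)
    (_ : c * x ^ 2 ∣ t₁ * y ^ 2) (_ : c * x ^ 2 ∣ t₂ * z ^ 2) :
    (p : ℤ_[p]) ^ e ∣ c * x ^ 2 := by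
  by_contra hne
  have hpe := (ValuationRing.dvd_total ((p : ℤ_[p]) ^ e) (c * x ^ 2)).resolve_left hne
  obtain ⟨g, hg⟩ := hpe
  have hgu : ¬ IsUnit g := fun hu => hne (by
    rw [hg]; exact (hu.mul_right_dvd).2 dvd_rfl)
  obtain ⟨f, rfl⟩ := (not_isUnit_iff_dvd g).1 hgu
  obtain ⟨d, hd⟩ := hd
  obtain ⟨w, hw⟩ := exists_sq_eq_one_add hp (-(f * d))
  have hx := (h (x * w) y z (by
    rw [hg] at hd
    linear_combination hd + c * x ^ 2 * hw)).1
  rcases mul_eq_zero.1 hx with hx | hx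
  · rw [hx] at hg
    exact (pow_ne_zero e PadicInt.prime_p.ne_zero) (by simpa using hg)
  · rw [hx] at hw
    exact PadicInt.prime_p.not_dvd_one ⟨f * d, by linear_combination -hw⟩

/-- The order of a value of an anisotropic diagonal form is the least order of its terms. -/
theorem Anisotropic.dvd (hp : p ≠ 2) {c t₁ t₂ : ℤ_[p]} (h : Anisotropic c t₁ t₂)
    {e : ℕ} {x y z : ℤ_[p]} (hd : (p : ℤ_[p]) ^ e ∣ c * x ^ 2 + t₁ * y ^ 2 + t₂ * z ^ 2) :
    (p : ℤ_[p]) ^ e ∣ c * x ^ 2 ∧ (p : ℤ_[p]) ^ e ∣ t₁ * y ^ 2 ∧ (p : ℤ_[p]) ^ e ∣ t₂ * z ^ 2 := by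
  have key : ∀ A B C : ℤ_[p], (A ∣ B ∧ A ∣ C) ∨ (B ∣ C ∧ B ∣ A) ∨ (C ∣ A ∧ C ∣ B) := by
    intro A B C
    rcases ValuationRing.dvd_total A B with h1 | h1 <;>
    rcases ValuationRing.dvd_total B C with h2 | h2 <;>
    rcases ValuationRing.dvd_total A C with h3 | h3
    · exact Or.inl ⟨h1, h3⟩
    · exact Or.inl ⟨h1, h1.trans h2⟩
    · exact Or.inl ⟨h1, h3⟩
    · exact Or.inr (Or.inr ⟨h3, h2⟩)
    · exact Or.inr (Or.inl ⟨h2, h1⟩)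
    · exact Or.inr (Or.inl ⟨h2, h1⟩)
    · exact Or.inr (Or.inr ⟨h2.trans h1, h2⟩)
    · exact Or.inr (Or.inr ⟨h3, h2⟩)
  rcases key (c * x ^ 2) (t₁ * y ^ 2) (t₂ * z ^ 2) with ⟨h1, h2⟩ | ⟨h1, h2⟩ | ⟨h1, h2⟩
  · have := h.dvd_of_dvd_terms hp hd h1 h2
    exact ⟨this, this.trans h1, this.trans h2⟩
  · have := h.rotate.dvd_of_dvd_terms hp (e := e) (x := y) (y := z) (z := x)
      (by convert hd using 1; ring) h1 h2
    exact ⟨this.trans h2, this, this.trans h1⟩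
  · have := h.rotate.rotate.dvd_of_dvd_terms hp (e := e) (x := z) (y := x) (z := y)
      (by convert hd using 1; ring) h1 h2
    exact ⟨this.trans h1, this.trans h2, this⟩

/-- Three units: the conic `u + v y² + w z² = 0` has a point modulo an odd prime. -/
theorem exists_dvd_add_sq (hp : p ≠ 2) {u v w : ℤ_[p]} (hv : IsUnit v) (hw : IsUnit w) :
    ∃ y z : ℤ_[p], (p : ℤ_[p]) ∣ u + v * y ^ 2 + w * z ^ 2 := by
  let π := PadicInt.toZMod (p := p)
  have hv' : π v ≠ 0 := (hv.map π).ne_zero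
  have hw' : π w ≠ 0 := (hw.map π).ne_zero
  obtain ⟨a, b, hab⟩ := FiniteField.exists_root_sum_quadratic (R := ZMod p)
    (f := C (π v) * X ^ 2 + C 0 * X + C (π u)) (g := C (π w) * X ^ 2 + C 0 * X + C 0)
    (degree_quadratic hv') (degree_quadratic hw') (by
      rw [ZMod.card]
      exact Nat.odd_iff.1 ((Fact.out : p.Prime).odd_of_ne_two hp))
  obtain ⟨y, rfl⟩ := ZMod.ringHom_surjective π a
  obtain ⟨z, rfl⟩ := ZMod.ringHom_surjective π b
  refine ⟨y, z, ?_⟩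
  rw [← Ideal.mem_span_singleton, ← PadicInt.maximalIdeal_eq_span_p, ← PadicInt.ker_toZMod,
    RingHom.mem_ker]
  simp only [map_add, map_mul, map_pow]
  simp at hab
  linear_combination hab

/-- An anisotropic ternary diagonal form does not have three coefficients of odd order. -/
theorem Anisotropic.not_odd (hp : p ≠ 2) {c t₁ t₂ u v w : ℤ_[p]} (h : Anisotropic c t₁ t₂)
    (hu : IsUnit u) (hv : IsUnit v) (hw : IsUnit w) {α β : ℕ} (hc : c = u * p)
    (h1 : t₁ = v * p ^ (2 * α + 1)) (h2 : t₂ = w * p ^ (2 * β + 1)) : False := by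
  obtain ⟨y, z, d, hd⟩ := exists_dvd_add_sq hp (u := u) hv hw
  -- The scaling gives all three terms the common factor `p ^ (2α + 2β + 1)`. The remaining conic is
  -- zero modulo `p`, which gains one more factor of `p`, although the first term has order exactly
  -- `2α + 2β + 1`.
  have := (h.dvd hp (e := 2 * α + 2 * β + 2) (x := p ^ (α + β)) (y := p ^ β * y)
    (z := p ^ α * z) ⟨d, by rw [hc, h1, h2]; linear_combination p ^ (2 * α + 2 * β + 1) * hd⟩).1
  have e : c * ((p : ℤ_[p]) ^ (α + β)) ^ 2 = p ^ (2 * α + 2 * β + 1) * u := by rw [hc]; ring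
  rw [e, pow_succ _ (2 * α + 2 * β + 1),
    mul_dvd_mul_iff_left (pow_ne_zero _ PadicInt.prime_p.ne_zero)] at this
  exact (not_isUnit_iff_dvd u).2 this hu

end Anisotropic

/-! ### Diagonalisation of `T`, and anisotropy of `diag(N, T)`. -/

section Diagonal

variable {p : ℕ} [Fact p.Prime]

/-- For odd `p`, a symmetric `2 × 2` matrix over `ℤ_p` is diagonalizable. -/
theorem exists_diagonal (hp : p ≠ 2) {T : Matrix (Fin 2) (Fin 2) ℤ_[p]} (hT : T.IsSymm) :
    ∃ (G G' : Matrix (Fin 2) (Fin 2) ℤ_[p]) (t₁ t₂ : ℤ_[p]), G * G' = 1 ∧ G' * G = 1 ∧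
      T = G.transpose * !![t₁, 0; 0, t₂] * G ∧ t₁ ∣ t₂ := by
  have h10 : T 1 0 = T 0 1 := hT.apply 0 1
  -- Completing the square, when the corner entry divides all others.
  have base : ∀ x y z : ℤ_[p], x ∣ y → x ∣ z →
      ∃ (G G' : Matrix (Fin 2) (Fin 2) ℤ_[p]) (t₁ t₂ : ℤ_[p]), G * G' = 1 ∧ G' * G = 1 ∧
      !![x, y; y, z] = G.transpose * !![t₁, 0; 0, t₂] * G ∧ t₁ ∣ t₂ := by
    rintro x y z ⟨e, rfl⟩ hz
    refine ⟨!![1, e; 0, 1], !![1, -e; 0, 1], x, z - x * e ^ 2, ?_, ?_, ?_,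
      dvd_sub hz (Dvd.intro _ rfl)⟩
    · ext i j; fin_cases i <;> fin_cases j <;> simp
    · ext i j; fin_cases i <;> fin_cases j <;> simp
    · ext i j; fin_cases i <;> fin_cases j <;> simp [Matrix.mul_apply, Fin.sum_univ_two] <;> ring
  have conj : ∀ H H' S : Matrix (Fin 2) (Fin 2) ℤ_[p], H * H' = 1 → H' * H = 1 →
      T = H.transpose * S * H →
      (∃ (G G' : Matrix (Fin 2) (Fin 2) ℤ_[p]) (t₁ t₂ : ℤ_[p]), G * G' = 1 ∧ G' * G = 1 ∧
      S = G.transpose * !![t₁, 0; 0, t₂] * G ∧ t₁ ∣ t₂) →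
      ∃ (G G' : Matrix (Fin 2) (Fin 2) ℤ_[p]) (t₁ t₂ : ℤ_[p]), G * G' = 1 ∧ G' * G = 1 ∧
      T = G.transpose * !![t₁, 0; 0, t₂] * G ∧ t₁ ∣ t₂ := by
    rintro H H' S h1 h2 h3 ⟨G, G', t₁, t₂, g1, g2, g3, g4⟩
    refine ⟨G * H, H' * G', t₁, t₂, ?_, ?_, ?_, g4⟩
    · calc G * H * (H' * G') = G * (H * H') * G' := by simp only [Matrix.mul_assoc]
        _ = 1 := by rw [h1, Matrix.mul_one, g1]
    · calc H' * G' * (G * H) = H' * (G' * G) * H := by simp only [Matrix.mul_assoc]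
        _ = 1 := by rw [g2, Matrix.mul_one, h2]
    · rw [h3, g3, Matrix.transpose_mul]; simp only [Matrix.mul_assoc]
  have hT' : T = !![T 0 0, T 0 1; T 0 1, T 1 1] := by
    ext i j; fin_cases i <;> fin_cases j <;> simp [h10]
  by_cases hx : T 0 0 ∣ T 0 1 ∧ T 0 0 ∣ T 1 1
  · rw [hT']; exact base _ _ _ hx.1 hx.2
  by_cases hz : T 1 1 ∣ T 0 1 ∧ T 1 1 ∣ T 0 0
  · refine conj !![0, 1; 1, 0] !![0, 1; 1, 0] !![T 1 1, T 0 1; T 0 1, T 0 0] ?_ ?_ ?_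
      (base _ _ _ hz.1 hz.2)
    · ext i j; fin_cases i <;> fin_cases j <;> simp
    · ext i j; fin_cases i <;> fin_cases j <;> simp
    · ext i j; fin_cases i <;> fin_cases j <;> simp [Matrix.mul_apply, Fin.sum_univ_two, h10]
  -- In the remaining case the off-diagonal entry has strictly the least order. Then the value of
  -- the form at `(1, 1)` is that entry times `2 + p (f + g)`, a unit, so a shear puts an entry of
  -- least order in the corner.
  have hy : T 0 1 * p ∣ T 0 0 ∧ T 0 1 * p ∣ T 1 1 := by
    have aux : ∀ x y : ℤ_[p], ¬ x ∣ y → y * p ∣ x := by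
      intro x y hxy
      obtain ⟨g, rfl⟩ := (ValuationRing.dvd_total x y).resolve_left hxy
      have hg : ¬ IsUnit g := fun hu => hxy ((hu.mul_right_dvd).2 dvd_rfl)
      exact mul_dvd_mul_left _ ((not_isUnit_iff_dvd g).1 hg)
    rcases ValuationRing.dvd_total (T 0 0) (T 1 1) with h | h
    · have h1 : T 0 1 * p ∣ T 0 0 := aux _ _ fun h' => hx ⟨h', h⟩
      exact ⟨h1, h1.trans h⟩
    · have h1 : T 0 1 * p ∣ T 1 1 := aux _ _ fun h' => hz ⟨h', h⟩
      exact ⟨h1.trans h, h1⟩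
  obtain ⟨⟨f, hf⟩, ⟨g, hg⟩⟩ := hy
  have hu : IsUnit (2 + (p : ℤ_[p]) * (f + g)) := by
    by_contra hu
    rw [not_isUnit_iff_dvd, dvd_add_left (Dvd.intro _ rfl)] at hu
    exact (not_isUnit_iff_dvd _).2 hu (isUnit_two hp)
  have hs : T 0 0 + 2 * T 0 1 + T 1 1 = T 0 1 * (2 + (p : ℤ_[p]) * (f + g)) := by
    linear_combination hf + hg
  have hd : T 0 0 + 2 * T 0 1 + T 1 1 ∣ T 0 1 := by
    rw [hs]; exact (hu.mul_right_dvd).2 dvd_rfl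
  have h1 : T 0 1 ∣ T 1 1 := ⟨_, by rw [hg, mul_assoc]⟩
  refine conj !![1, 0; -1, 1] !![1, 0; 1, 1]
    !![T 0 0 + 2 * T 0 1 + T 1 1, T 0 1 + T 1 1; T 0 1 + T 1 1, T 1 1] ?_ ?_ ?_
    (base _ _ _ (dvd_add hd (hd.trans h1)) (hd.trans h1))
  · ext i j; fin_cases i <;> fin_cases j <;> simp
  · ext i j; fin_cases i <;> fin_cases j <;> simp
  · ext i j; fin_cases i <;> fin_cases j <;> simp [Matrix.mul_apply, Fin.sum_univ_two, h10] <;> ring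

/-- If `T ≅ diag(t₁, t₂)` is not represented by the traceless matrices, then
`diag(N, t₁, t₂)` is anisotropic. -/
theorem anisotropic_of_not_represents {N : ℕ} (hN : N ≠ 0)
    {T G G' : Matrix (Fin 2) (Fin 2) ℤ_[p]} {t₁ t₂ : ℤ_[p]} (hG : G * G' = 1)
    (hT : T = G.transpose * !![t₁, 0; 0, t₂] * G)
    (hrep : ¬ Represents (levelForm p N) (T.map fun t => (t : ℚ_[p]))) :
    Anisotropic (N : ℤ_[p]) t₁ t₂ := by
  have hN' : (N : ℚ_[p]) ≠ 0 := by exact_mod_cast hN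
  have hsym : T.IsSymm := by
    rw [hT]
    ext i j
    fin_cases i <;> fin_cases j <;> simp [Matrix.mul_apply, Fin.sum_univ_two] <;> ring
  intro x y z h
  by_cases hyz : y = 0 ∧ z = 0
  · obtain ⟨rfl, rfl⟩ := hyz
    have : (N : ℤ_[p]) ≠ 0 := by exact_mod_cast hN
    simpa [this] using h
  exfalso
  have g : ∀ i j, (G * G') i j = (1 : Matrix (Fin 2) (Fin 2) ℤ_[p]) i j := fun i j => by rw [hG]
  have g00 := g 0 0
  have g01 := g 0 1
  have g10 := g 1 0
  have g11 := g 1 1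
  simp [Matrix.mul_apply, Fin.sum_univ_two] at g00 g01 g10 g11
  -- The zero `(y, z)` is carried back to the original basis by `G'`.
  set n₁ := G' 0 0 * y + G' 0 1 * z with hn₁
  set n₂ := G' 1 0 * y + G' 1 1 * z with hn₂
  have e1 : G 0 0 * n₁ + G 0 1 * n₂ = y := by
    rw [hn₁, hn₂]; linear_combination y * g00 + z * g01
  have e2 : G 1 0 * n₁ + G 1 1 * n₂ = z := by
    rw [hn₁, hn₂]; linear_combination y * g10 + z * g11
  have hn : (n₁ : ℚ_[p]) ≠ 0 ∨ (n₂ : ℚ_[p]) ≠ 0 := by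
    by_contra! hc
    have hc1 : n₁ = 0 := Subtype.ext hc.1
    have hc2 : n₂ = 0 := Subtype.ext hc.2
    rw [hc1, hc2] at e1 e2
    exact hyz ⟨by simpa using e1.symm, by simpa using e2.symm⟩
  refine hrep (represents_of_isotropic (x := x) hN' (hsym.map _) hn ?_)
  have : T 0 0 * n₁ ^ 2 + 2 * T 0 1 * n₁ * n₂ + T 1 1 * n₂ ^ 2 + N * x ^ 2 = 0 := by
    have e3 : T 0 0 * n₁ ^ 2 + 2 * T 0 1 * n₁ * n₂ + T 1 1 * n₂ ^ 2 =
        t₁ * (G 0 0 * n₁ + G 0 1 * n₂) ^ 2 + t₂ * (G 1 0 * n₁ + G 1 1 * n₂) ^ 2 := by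
      rw [hT]
      simp [Matrix.mul_apply, Fin.sum_univ_two]
      ring
    rw [e3, e1, e2]
    linear_combination h
  simp only [Matrix.map_apply]
  exact_mod_cast congrArg (fun t : ℤ_[p] => (t : ℚ_[p])) this

end Diagonal

/-! ### Gross–Keating invariants of diagonal ternary forms. -/

section GrossKeating

variable {p : ℕ} [Fact p.Prime]

theorem pow_dvd_of_sq_dvd {s : ℕ} {x : ℤ_[p]} (h : (p : ℤ_[p]) ^ (2 * s) ∣ x ^ 2) :
    (p : ℤ_[p]) ^ s ∣ x := by
  rw [mul_comm, pow_mul] at h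
  exact (IsIntegrallyClosed.pow_dvd_pow_iff two_ne_zero).1 h

/-- The Gross–Keating invariants of a ternary form that is diagonalizable over `ℤ_p`, `p` odd, are
the orders of its diagonal coefficients. -/
theorem isGrossKeating_of_diagonal (hp : p ≠ 2) {B G G' : Matrix (Fin 3) (Fin 3) ℤ_[p]}
    (hG : G * G' = 1) (hG' : G' * G = 1) {d u : Fin 3 → ℤ_[p]} {c : Fin 3 → ℕ}
    (hu : ∀ i, IsUnit (u i)) (hd : ∀ i, d i = u i * p ^ c i) (hc : Monotone c)
    (hB : B = G.transpose * Matrix.diagonal d * G) : IsGrossKeating B c := by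
  have hp0 : (p : ℤ_[p]) ≠ 0 := PadicInt.prime_p.ne_zero
  have hpow : ∀ {s t : ℕ}, (p : ℤ_[p]) ^ s ∣ p ^ t → s ≤ t := fun {s t} h =>
    (pow_dvd_pow_iff hp0 PadicInt.prime_p.not_isUnit).1 h
  refine ⟨⟨hc, G', ?_, ?_⟩, ?_⟩
  · rw [Matrix.isUnit_iff_isUnit_det (A := G') |>.symm]
    exact ⟨⟨G', G, hG', hG⟩, rfl⟩
  · have e : G'.transpose * B * G' = Matrix.diagonal d := by
      rw [hB]
      calc G'.transpose * (G.transpose * Matrix.diagonal d * G) * G'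
          = (G * G').transpose * Matrix.diagonal d * (G * G') := by
            simp only [Matrix.transpose_mul, Matrix.mul_assoc]
        _ = _ := by rw [hG]; simp
    intro i j hij
    rw [e]
    by_cases h : i = j
    · subst h
      simp only [formCoeff, if_true, Matrix.diagonal_apply_eq, hd]
      exact ⟨u i ^ 2, by simp only [ofLex_toLex]; ring⟩
    · simp [formCoeff, h]
  · rintro y ⟨hy, U, hU, hdvd⟩
    obtain ⟨y, rfl⟩ := toLex.surjective y
    simp only [ofLex_toLex] at hy hdvd
    -- the matrix `E` in the basis `U` is equivalent to the diagonal matrix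
    set E := U.transpose * B * U with hE
    set W := U⁻¹ * G' with hW
    set W' := G * U with hW'
    have hWW : W' * W = 1 := by
      rw [hW, hW', Matrix.mul_assoc, ← Matrix.mul_assoc U, Matrix.mul_nonsing_inv U hU,
        Matrix.one_mul, hG]
    have hE' : E = W'.transpose * Matrix.diagonal d * W' := by
      rw [hE, hB, hW', Matrix.transpose_mul]; simp only [Matrix.mul_assoc]
    have hD : Matrix.diagonal d = W.transpose * E * W := by
      rw [hE']
      calc Matrix.diagonal d = (W' * W).transpose * Matrix.diagonal d * (W' * W) := by
            rw [hWW]; simp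
        _ = _ := by simp only [Matrix.transpose_mul, Matrix.mul_assoc]
    have hsymm : E.transpose = E := by
      rw [hE']; simp [Matrix.mul_assoc]
    have hent : ∀ i j, (p : ℤ_[p]) ^ (y i + y j) ∣ E i j ^ 2 := by
      have h1 : ∀ i j, i ≤ j → (p : ℤ_[p]) ^ (y i + y j) ∣ E i j ^ 2 := by
        intro i j hij
        have := hdvd i j hij
        unfold formCoeff at this
        split_ifs at this with h
        · subst h; exact this
        · rw [mul_pow] at this
          exact (((isUnit_two hp).pow 2).dvd_mul_left).1 this
      intro i j
      rcases le_total i j with h | h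
      · exact h1 i j h
      · have := h1 j i h
        rw [add_comm, ← hsymm]
        exact this
    have h01 : y 0 ≤ y 1 := hy (by decide)
    have h12 : y 1 ≤ y 2 := hy (by decide)
    have hge : ∀ i, y 0 ≤ y i := fun i => hy (Fin.zero_le i)
    -- The ideals generated by the entries, the `2 × 2` minors and the determinant do not change
    -- under equivalence. Bounding their orders below for `E` bounds `y 0`, `y 0 + y 1` and `y 0 + y
    -- 1 + y 2` above by the partial sums of `c`.
    have sand : ∀ (s : ℕ) (F : Matrix (Fin 3) (Fin 3) ℤ_[p]) (A C : Matrix (Fin 3) (Fin 3) ℤ_[p]),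
        (∀ i j, (p : ℤ_[p]) ^ s ∣ F i j) → ∀ i j, (p : ℤ_[p]) ^ s ∣ (A * F * C) i j := by
      intro s F A C h i j
      rw [Matrix.mul_apply]
      refine Finset.dvd_sum fun k _ => Dvd.dvd.mul_right ?_ _
      rw [Matrix.mul_apply]
      exact Finset.dvd_sum fun l _ => Dvd.dvd.mul_left (h l k) _
    have k1 : y 0 ≤ c 0 := by
      have h := sand (y 0) E W.transpose W (fun i j => pow_dvd_of_sq_dvd
        ((pow_dvd_pow _ (by have := hge i; have := hge j; omega)).trans (hent i j))) 0 0
      rw [← hD, Matrix.diagonal_apply_eq, hd, (hu 0).dvd_mul_left] at h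
      exact hpow h
    -- A product `E i j * E k l` has order at least half of `y i + y j + y k + y l`; distinct rows
    -- and distinct columns each contribute at least `y 0 + y 1`.
    have minor : ∀ i j k l i' j' k' l' : Fin 3, y 0 + y 1 ≤ y i + y k → y 0 + y 1 ≤ y j + y l →
        y 0 + y 1 ≤ y i' + y k' → y 0 + y 1 ≤ y j' + y l' →
        (p : ℤ_[p]) ^ (y 0 + y 1) ∣ E i j * E k l - E i' j' * E k' l' := by
      have : ∀ i j k l : Fin 3, y 0 + y 1 ≤ y i + y k → y 0 + y 1 ≤ y j + y l →
          (p : ℤ_[p]) ^ (y 0 + y 1) ∣ E i j * E k l := by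
        intro i j k l h1 h2
        refine pow_dvd_of_sq_dvd ?_
        rw [mul_pow]
        refine (pow_dvd_pow _ ?_).trans ((pow_add (p : ℤ_[p]) _ _).symm ▸
          mul_dvd_mul (hent i j) (hent k l))
        omega
      intro i j k l i' j' k' l' h1 h2 h3 h4
      exact dvd_sub (this _ _ _ _ h1 h2) (this _ _ _ _ h3 h4)
    have k2 : y 0 + y 1 ≤ c 0 + c 1 := by
      have hadj : ∀ i j, (p : ℤ_[p]) ^ (y 0 + y 1) ∣ E.adjugate i j := by
        intro i j
        rw [Matrix.adjugate_fin_three]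
        fin_cases i <;> fin_cases j <;> simp only [Matrix.of_apply, Matrix.cons_val', Matrix.cons_val,
          Fin.mk_one, Fin.zero_eta, Fin.isValue, Fin.reduceFinMk, neg_add_eq_sub] <;>
          apply minor <;> omega
      have h := sand _ _ W.adjugate W.adjugate.transpose hadj 2 2
      rw [Matrix.adjugate_transpose, ← Matrix.adjugate_mul_distrib, ← Matrix.adjugate_mul_distrib,
        ← Matrix.mul_assoc, ← hD] at h
      have e : (Matrix.diagonal d).adjugate 2 2 = (u 0 * u 1) * p ^ (c 0 + c 1) := by
        rw [Matrix.adjugate_fin_three]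
        simp [Matrix.diagonal, hd]
        ring
      rw [e, ((hu 0).mul (hu 1)).dvd_mul_left] at h
      exact hpow h
    have k3 : y 0 + y 1 + y 2 ≤ c 0 + c 1 + c 2 := by
      have hterm : ∀ i j k : Fin 3, y 0 + y 1 + y 2 ≤ y i + y j + y k →
          (p : ℤ_[p]) ^ (y 0 + y 1 + y 2) ∣ E 0 i * E 1 j * E 2 k := by
        intro i j k h
        refine pow_dvd_of_sq_dvd ?_
        rw [mul_pow, mul_pow]
        refine (pow_dvd_pow _ ?_).trans (mul_dvd_mul (mul_dvd_mul (hent 0 i) (hent 1 j)) (hent 2 k) |>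
          fun h => by rwa [← pow_add, ← pow_add] at h)
        omega
      have hdet : (p : ℤ_[p]) ^ (y 0 + y 1 + y 2) ∣ E.det := by
        rw [Matrix.det_fin_three]
        have e : ∀ a b c' d' e' f : ℤ_[p], (p : ℤ_[p]) ^ (y 0 + y 1 + y 2) ∣ a → 
            (p : ℤ_[p]) ^ (y 0 + y 1 + y 2) ∣ b → (p : ℤ_[p]) ^ (y 0 + y 1 + y 2) ∣ c' →
            (p : ℤ_[p]) ^ (y 0 + y 1 + y 2) ∣ d' → (p : ℤ_[p]) ^ (y 0 + y 1 + y 2) ∣ e' →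
            (p : ℤ_[p]) ^ (y 0 + y 1 + y 2) ∣ f →
            (p : ℤ_[p]) ^ (y 0 + y 1 + y 2) ∣ a - b - c' + d' + e' - f := by
          intro a b c' d' e' f h1 h2 h3 h4 h5 h6
          exact dvd_sub (dvd_add (dvd_add (dvd_sub (dvd_sub h1 h2) h3) h4) h5) h6
        apply e <;> apply hterm <;> omega
      have h : (p : ℤ_[p]) ^ (y 0 + y 1 + y 2) ∣ (Matrix.diagonal d).det := by
        rw [hD, Matrix.det_mul, Matrix.det_mul]
        exact Dvd.dvd.mul_right (Dvd.dvd.mul_left hdet _) _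
      have e : (Matrix.diagonal d).det = (u 0 * u 1 * u 2) * p ^ (c 0 + c 1 + c 2) := by
        rw [Matrix.det_diagonal, Fin.prod_univ_three, hd, hd, hd]; ring
      rw [e, (((hu 0).mul (hu 1)).mul (hu 2)).dvd_mul_left] at h
      exact hpow h
    -- The three bounds on partial sums imply the lexicographic bound: at the first index where `y`
    -- and `c` differ, `y` is smaller.
    by_cases e0 : y 0 = c 0
    · by_cases e1 : y 1 = c 1
      · by_cases e2 : y 2 = c 2
        · refine le_of_eq (congrArg toLex ?_)
          ext i; fin_cases i <;> assumption
        · refine le_of_lt ⟨2, ?_, ?_⟩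
          · intro j hj
            fin_cases j
            · exact e0
            · exact e1
            · exact absurd hj (lt_irrefl _)
          · show y 2 < c 2
            omega
      · refine le_of_lt ⟨1, ?_, ?_⟩
        · intro j hj
          fin_cases j
          · exact e0
          · exact absurd hj (lt_irrefl _)
          · exact absurd hj (by decide)
        · show y 1 < c 1
          omega
    · refine le_of_lt ⟨0, ?_, ?_⟩
      · intro j hj
        exact absurd hj (by simp)
      · show y 0 < c 0
        omega

end GrossKeating

/-! ### Densities of subsets of finite groups. -/

noncomputable section Dens

variable {G H : Type*}

/-- The proportion of the elements of a finite type that lie in `S`. -/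
def dens (S : Set G) : ℝ := (S.ncard : ℝ) / Nat.card G

theorem dens_empty : dens (∅ : Set G) = 0 := by simp [dens]

theorem dens_univ [Finite G] [Nonempty G] : dens (Set.univ : Set G) = 1 := by
  have : (Nat.card G : ℝ) ≠ 0 := by exact_mod_cast Nat.card_pos.ne'
  rw [dens, Set.ncard_univ, div_self this]

theorem dens_singleton (x : G) : dens {x} = (Nat.card G : ℝ)⁻¹ := by
  simp [dens]

theorem dens_union [Finite G] {S T : Set G} (h : Disjoint S T) :
    dens (S ∪ T) = dens S + dens T := by
  rw [dens, dens, dens, Set.ncard_union_eq h, Nat.cast_add, add_div]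

theorem dens_compl [Finite G] [Nonempty G] (S : Set G) : dens Sᶜ = 1 - dens S := by
  have h := dens_union (S := S) (T := Sᶜ) disjoint_compl_right
  rw [Set.union_compl_self, dens_univ] at h
  linarith

theorem dens_biUnion [Finite G] {ι : Type*} (I : Finset ι) (S : ι → Set G)
    (h : ∀ i ∈ I, ∀ j ∈ I, ∀ g, g ∈ S i → g ∈ S j → i = j) :
    dens (⋃ i ∈ I, S i) = ∑ i ∈ I, dens (S i) := by
  classical
  induction I using Finset.induction_on with
  | empty => simp [dens_empty]
  | insert a I ha ih =>
    rw [Finset.set_biUnion_insert, Finset.sum_insert ha, dens_union, ih]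
    · exact fun i hi j hj => h i (Finset.mem_insert_of_mem hi) j (Finset.mem_insert_of_mem hj)
    · rw [Set.disjoint_left]
      intro g hg hg'
      simp only [Set.mem_iUnion] at hg'
      obtain ⟨i, hi, hgi⟩ := hg'
      have := h a (Finset.mem_insert_self _ _) i (Finset.mem_insert_of_mem hi) g hg hgi
      exact ha (this ▸ hi)

theorem dens_prod (A : Set G) (B : Set H) : dens (A ×ˢ B) = dens A * dens B := by
  rw [dens, dens, dens, Set.ncard_prod, Nat.card_prod]
  push_cast
  rw [div_mul_div_comm]

theorem dens_preimage_equiv (e : G ≃ H) (S : Set H) : dens (e ⁻¹' S) = dens S := by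
  rw [dens, dens, Nat.card_congr e, Set.ncard_preimage_of_injective_subset_range e.injective
    (by simp)]

theorem dens_pi {ι : Type*} [Fintype ι] [Finite G] (A : ι → Set G) :
    dens {x : ι → G | ∀ l, x l ∈ A l} = ∏ l, dens (A l) := by
  have e : {x : ι → G | ∀ l, x l ∈ A l} ≃ ∀ l, A l :=
    Equiv.subtypePiEquivPi (p := fun l x => x ∈ A l)
  have h : {x : ι → G | ∀ l, x l ∈ A l}.ncard = ∏ l, (A l).ncard := by
    rw [← Nat.card_coe_set_eq, Nat.card_congr e, Nat.card_pi]
    simp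
  simp only [dens]
  rw [h, Finset.prod_div_distrib, Nat.card_pi]
  push_cast
  rfl

/-- The density of a set that has fibres of density `c` over `A`, and is empty outside of `A`. -/
theorem dens_fiber [Finite G] [Finite H] {S : Set (G × H)} {A : Set G} {c : ℝ}
    (h : ∀ g ∈ A, dens {x | (g, x) ∈ S} = c) (h' : ∀ g ∉ A, ∀ x, (g, x) ∉ S) :
    dens S = c * dens A := by
  classical
  have := Fintype.ofFinite G
  have e : S ≃ Σ g : G, {x | (g, x) ∈ S} :=
    { toFun := fun s => ⟨s.1.1, s.1.2, s.2⟩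
      invFun := fun s => ⟨(s.1, s.2.1), s.2.2⟩
      left_inv := fun _ => rfl
      right_inv := fun _ => rfl }
  have h1 : S.ncard = ∑ g : G, {x | (g, x) ∈ S}.ncard := by
    rw [← Nat.card_coe_set_eq, Nat.card_congr e, Nat.card_sigma]
    simp
  have h2 : ∀ g : G, ({x | (g, x) ∈ S}.ncard : ℝ) / Nat.card H = if g ∈ A then c else 0 := by
    intro g
    split_ifs with hg
    · exact h g hg
    · have : {x | (g, x) ∈ S} = ∅ := Set.eq_empty_iff_forall_notMem.2 (h' g hg)
      simp [this]
  have h3 : (S.ncard : ℝ) / Nat.card H = c * A.ncard := by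
    rw [h1, Nat.cast_sum, Finset.sum_div, Finset.sum_congr rfl fun g _ => h2 g, ← Finset.sum_filter,
      Finset.sum_const, nsmul_eq_mul, mul_comm, Set.ncard_eq_toFinset_card' A]
    congr 3
    ext; simp
  rw [dens, dens, Nat.card_prod, Nat.cast_mul, mul_comm (Nat.card G : ℝ), ← div_div, h3,
    mul_div_assoc]

variable [AddCommGroup G] [AddCommGroup H]

/-- A surjective homomorphism splits as a map of sets. -/
def splitOfSurjective (f : G →+ H) (hf : Function.Surjective f) : G ≃ H × f.ker where
  toFun g := (f g, ⟨g - Function.surjInv hf (f g), by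
    rw [AddMonoidHom.mem_ker, map_sub, Function.surjInv_eq hf, sub_self]⟩)
  invFun x := x.2 + Function.surjInv hf x.1
  left_inv g := by simp
  right_inv x := by
    have h : f (x.2 + Function.surjInv hf x.1) = x.1 := by
      rw [map_add, Function.surjInv_eq hf, AddMonoidHom.mem_ker.1 x.2.2, zero_add]
    ext <;> simp [Function.surjInv_eq hf, AddMonoidHom.mem_ker.1 x.2.2]

theorem dens_preimage [Finite G] (f : G →+ H) (hf : Function.Surjective f) (S : Set H) :
    dens (f ⁻¹' S) = dens S := by
  have : f ⁻¹' S = splitOfSurjective f hf ⁻¹' (S ×ˢ Set.univ) := by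
    ext g; simp [splitOfSurjective]
  rw [this, dens_preimage_equiv, dens_prod, dens_univ, mul_one]

theorem card_eq_card_range_mul (f : G →+ H) :
    Nat.card G = Nat.card f.range * Nat.card f.ker := by
  rw [Nat.card_congr (splitOfSurjective f.rangeRestrict f.rangeRestrict_surjective),
    Nat.card_prod, f.ker_rangeRestrict]

/-- `S` is a union of fibres of `f`, each a coset of the kernel, so `S` has `|ker f|` times as many
elements as its image. -/
theorem dens_image [Finite G] (f : G →+ G) {S : Set G} (hS : ∀ x ∈ S, ∀ y, f y = f x → y ∈ S) :
    dens S = dens (f '' S) * Nat.card f.ker := by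
  have h1 : S = splitOfSurjective f.rangeRestrict f.rangeRestrict_surjective ⁻¹'
      ((Subtype.val ⁻¹' (f '' S)) ×ˢ Set.univ) := by
    ext g
    simp only [splitOfSurjective, Set.mem_preimage, Equiv.coe_fn_mk, Set.mem_prod,
      AddMonoidHom.coe_rangeRestrict, Set.mem_univ, and_true]
    exact ⟨fun h => ⟨g, h, rfl⟩, fun ⟨x, hx, hxg⟩ => hS x hx g hxg.symm⟩
  have h2 : (Subtype.val ⁻¹' (f '' S) : Set f.range).ncard = (f '' S).ncard :=
    Set.ncard_preimage_of_injective_subset_range Subtype.val_injective (by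
      rintro _ ⟨x, -, rfl⟩; exact ⟨⟨f x, x, rfl⟩, rfl⟩)
  have h3 := card_eq_card_range_mul f
  have hG : (Nat.card G : ℝ) ≠ 0 := by exact_mod_cast Nat.card_pos.ne'
  conv_lhs => rw [h1]
  rw [dens_preimage_equiv, dens_prod, dens_univ, mul_one, dens, dens, h2]
  have h4 : (Nat.card G : ℝ) = Nat.card f.range * Nat.card f.ker := by exact_mod_cast h3
  have h5 : (Nat.card f.range : ℝ) ≠ 0 := by exact_mod_cast Nat.card_pos.ne'
  have h6 : (Nat.card f.ker : ℝ) ≠ 0 := by exact_mod_cast Nat.card_pos.ne'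
  rw [h4]
  field_simp

end Dens

/-! ### Arithmetic and densities in `ℤ_p / p ^ k`. -/

section Truncation

variable {p : ℕ} [Fact p.Prime] {k : ℕ} {R : Type*} [CommRing R] [Algebra ℤ_[p] R]

variable (p k R) in
/-- `R` is the quotient `ℤ_p / p ^ k`. -/
structure IsTruncation : Prop where
  surj : Function.Surjective (algebraMap ℤ_[p] R)
  ker : ∀ x, algebraMap ℤ_[p] R x = 0 ↔ (p : ℤ_[p]) ^ k ∣ x

namespace IsTruncation

theorem dvd_iff (hR : IsTruncation p k R) {j : ℕ} (hj : j ≤ k) (x : ℤ_[p]) :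
    (p : R) ^ j ∣ algebraMap ℤ_[p] R x ↔ (p : ℤ_[p]) ^ j ∣ x := by
  constructor
  · rintro ⟨y, hy⟩
    obtain ⟨y, rfl⟩ := hR.surj y
    have : algebraMap ℤ_[p] R (x - p ^ j * y) = 0 := by simp [hy]
    rw [hR.ker] at this
    have h := dvd_add ((pow_dvd_pow _ hj).trans this) (Dvd.intro y rfl)
    simpa using h
  · rintro ⟨y, rfl⟩
    exact ⟨algebraMap ℤ_[p] R y, by simp⟩

theorem pow_eq_zero (hR : IsTruncation p k R) : (p : R) ^ k = 0 := by
  have := (hR.ker (p ^ k)).2 dvd_rfl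
  simpa using this

theorem dvd_of_mul_eq_zero (hR : IsTruncation p k R) {i : ℕ} (hi : i ≤ k) {x : R}
    (h : (p : R) ^ i * x = 0) : (p : R) ^ (k - i) ∣ x := by
  obtain ⟨x, rfl⟩ := hR.surj x
  rw [hR.dvd_iff (Nat.sub_le _ _)]
  have : algebraMap ℤ_[p] R (p ^ i * x) = 0 := by simpa using h
  rw [hR.ker] at this
  obtain ⟨l, rfl⟩ := Nat.exists_eq_add_of_le hi
  rw [pow_add, mul_dvd_mul_iff_left (pow_ne_zero _ PadicInt.prime_p.ne_zero)] at this
  simpa using this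

theorem mul_eq_zero_iff (hR : IsTruncation p k R) {i : ℕ} (hi : i ≤ k) {x : R} :
    (p : R) ^ i * x = 0 ↔ (p : R) ^ (k - i) ∣ x := by
  refine ⟨hR.dvd_of_mul_eq_zero hi, ?_⟩
  rintro ⟨y, rfl⟩
  rw [← mul_assoc, ← pow_add, Nat.add_sub_cancel' hi, hR.pow_eq_zero, zero_mul]

theorem dvd_of_mul_eq_mul (hR : IsTruncation p k R) {i : ℕ} (hi : i < k) {x y : R}
    (h : (p : R) ^ i * x = (p : R) ^ i * y) : (p : R) ∣ x - y := by
  have := hR.dvd_of_mul_eq_zero hi.le (x := x - y) (by rw [mul_sub, h, sub_self])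
  exact (dvd_pow_self _ (by omega)).trans this

theorem not_isUnit_iff (hR : IsTruncation p k R) (hk : 0 < k) (x : R) :
    ¬ IsUnit x ↔ (p : R) ∣ x := by
  obtain ⟨x, rfl⟩ := hR.surj x
  have h1 := hR.dvd_iff (j := 1) hk x
  rw [pow_one, pow_one] at h1
  rw [h1]
  constructor
  · intro h
    rw [← not_isUnit_iff_dvd]
    exact fun hu => h (hu.map _)
  · intro h hu
    obtain ⟨y, hy⟩ := hu.exists_right_inv
    have h2 : (p : R) ^ 1 ∣ algebraMap ℤ_[p] R 1 := by
      rw [map_one, ← hy, pow_one]; exact Dvd.dvd.mul_right (by simpa using h1.2 h) _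
    rw [hR.dvd_iff hk, pow_one] at h2
    exact PadicInt.prime_p.not_dvd_one h2

theorem natCast_dvd_iff (hR : IsTruncation p k R) {j : ℕ} (hj : j ≤ k) (s : ℤ) :
    (p : R) ^ j ∣ (s : R) ↔ (p : ℤ) ^ j ∣ s := by
  rw [← PadicInt.pow_p_dvd_int_iff, ← hR.dvd_iff hj]
  simp

/-- The set is the kernel of the induced surjection from `R` to `ℤ / p ^ e`. -/
theorem dens_dvd [Finite R] (hR : IsTruncation p k R) {e : ℕ} (he : e ≤ k) :
    dens {x : R | (p : R) ^ e ∣ x} = ((p : ℝ) ^ e)⁻¹ := by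
  have hle : RingHom.ker (algebraMap ℤ_[p] R) ≤ RingHom.ker (PadicInt.toZModPow (p := p) e) := by
    intro x hx
    rw [RingHom.mem_ker, hR.ker] at hx
    rw [PadicInt.ker_toZModPow, Ideal.mem_span_singleton]
    exact (pow_dvd_pow _ he).trans hx
  let g : R →+* ZMod (p ^ e) := RingHom.liftOfSurjective _ hR.surj ⟨_, hle⟩
  have hg : ∀ x, g (algebraMap ℤ_[p] R x) = PadicInt.toZModPow e x := fun x =>
    RingHom.liftOfRightInverse_comp_apply _ _ _ ⟨_, hle⟩ x
  have : {x : R | (p : R) ^ e ∣ x} = g.toAddMonoidHom ⁻¹' {0} := by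
    ext x
    obtain ⟨x, rfl⟩ := hR.surj x
    rw [Set.mem_ofPred_eq, hR.dvd_iff he, ← Ideal.mem_span_singleton, ← PadicInt.ker_toZModPow,
      RingHom.mem_ker]
    simp [hg]
  rw [this, dens_preimage _ (ZMod.ringHom_surjective g), dens_singleton, Nat.card_zmod]
  push_cast
  rfl

theorem card [Finite R] (hR : IsTruncation p k R) : Nat.card R = p ^ k := by
  have h := hR.dens_dvd le_rfl
  have : {x : R | (p : R) ^ k ∣ x} = {0} := by
    ext x; simp [hR.pow_eq_zero]
  rw [this, dens_singleton] at h
  exact_mod_cast inv_injective h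

/-- The density of the solutions of `p ^ e x = w`. -/
theorem dens_mul_eq [Finite R] (hR : IsTruncation p k R) {e : ℕ} (he : e ≤ k) {w : R}
    (hw : (p : R) ^ e ∣ w) : dens {x : R | (p : R) ^ e * x = w} = (p : ℝ) ^ e / (p : ℝ) ^ k := by
  obtain ⟨y, rfl⟩ := hw
  have hp : (p : ℝ) ≠ 0 := by exact_mod_cast (Fact.out : p.Prime).ne_zero
  have : {x : R | (p : R) ^ e * x = p ^ e * y} =
      Equiv.subRight y ⁻¹' {x | (p : R) ^ (k - e) ∣ x} := by
    ext x
    rw [Set.mem_ofPred_eq, ← sub_eq_zero, ← mul_sub, hR.mul_eq_zero_iff he]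
    rfl
  rw [this, dens_preimage_equiv, hR.dens_dvd (Nat.sub_le _ _), pow_sub₀ _ hp he]
  field_simp

theorem card_ker_mul [Finite R] (hR : IsTruncation p k R) {e : ℕ} (he : e ≤ k) :
    Nat.card {x : R // (p : R) ^ e * x = 0} = p ^ e := by
  have h := hR.dens_mul_eq he (dvd_zero _)
  have hp : (p : ℝ) ≠ 0 := by exact_mod_cast (Fact.out : p.Prime).ne_zero
  have hp' : (p : ℝ) ^ k ≠ 0 := pow_ne_zero _ hp
  rw [dens, hR.card, Nat.cast_pow, div_left_inj' hp', ← Nat.card_coe_set_eq] at h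
  exact_mod_cast h

end IsTruncation

/-- The quotient `ℤ_p / p ^ k`. -/
theorem isTruncation_quotient (p k : ℕ) [Fact p.Prime] :
    IsTruncation p k (ℤ_[p] ⧸ Ideal.span {(p : ℤ_[p]) ^ k}) where
  surj := Ideal.Quotient.mk_surjective
  ker x := by
    rw [Ideal.Quotient.algebraMap_eq, Ideal.Quotient.eq_zero_iff_mem, Ideal.mem_span_singleton]

theorem finite_quotient (p k : ℕ) [Fact p.Prime] :
    Finite (ℤ_[p] ⧸ Ideal.span {(p : ℤ_[p]) ^ k}) := by
  have e := RingHom.quotientKerEquivOfSurjective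
    (ZMod.ringHom_surjective (PadicInt.toZModPow (p := p) k))
  have : NeZero (p ^ k) := ⟨pow_ne_zero _ (Fact.out : p.Prime).ne_zero⟩
  rw [← PadicInt.ker_toZModPow]
  exact Finite.of_equiv _ e.symm.toEquiv

end Truncation

/-! ### Normal forms of pairs of vectors: the cells. -/

section Cell

variable {p : ℕ} [Fact p.Prime] {k m : ℕ} {R : Type*} [CommRing R] [Algebra ℤ_[p] R]

/-- Some `2 × 2` minor of the pair of vectors `α, β` is a unit. -/
def Unimodular (α β : Fin m → R) : Prop := ∃ l l', IsUnit (α l * β l' - α l' * β l)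

theorem Unimodular.exists_isUnit (hR : IsTruncation p k R) (hk : 0 < k) {α β : Fin m → R}
    (h : Unimodular α β) : ∃ l, IsUnit (α l) := by
  by_contra! hα
  obtain ⟨l, l', h⟩ := h
  refine (hR.not_isUnit_iff hk _).2 (dvd_sub ?_ ?_) h
  · exact ((hR.not_isUnit_iff hk _).1 (hα l)).mul_right _
  · exact ((hR.not_isUnit_iff hk _).1 (hα l')).mul_right _

theorem Unimodular.symm {α β : Fin m → R} (h : Unimodular α β) : Unimodular β α := by
  obtain ⟨l, l', h⟩ := h
  exact ⟨l', l, by convert h using 1; ring⟩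

theorem Unimodular.congr (hR : IsTruncation p k R) (hk : 0 < k) {α β α' β' : Fin m → R}
    (h : Unimodular α β) (hα : ∀ l, (p : R) ∣ α' l - α l) (hβ : ∀ l, (p : R) ∣ β' l - β l) :
    Unimodular α' β' := by
  obtain ⟨l, l', h⟩ := h
  refine ⟨l, l', ?_⟩
  by_contra h'
  refine (hR.not_isUnit_iff hk _).2 ?_ h
  rw [hR.not_isUnit_iff hk] at h'
  have : α l * β l' - α l' * β l = (α' l * β' l' - α' l' * β' l) - ((α' l - α l) * β' l' +
      α l * (β' l' - β l') - (α' l' - α l') * β' l - α l' * (β' l - β l)) := by ring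
  rw [this]
  exact dvd_sub h' (dvd_sub (dvd_sub (dvd_add ((hα l).mul_right _) ((hβ l').mul_left _))
    ((hα l').mul_right _)) ((hβ l).mul_left _))

theorem IsTruncation.exists_natCast (hR : IsTruncation p k R) {e : ℕ} (x : R) :
    ∃ n < p ^ e, (p : R) ^ e ∣ x - (n : R) := by
  obtain ⟨x, rfl⟩ := hR.surj x
  refine ⟨x.appr e, x.appr_lt e, ?_⟩
  obtain ⟨y, hy⟩ := Ideal.mem_span_singleton.1 (x.appr_spec e)
  have := congrArg (algebraMap ℤ_[p] R) hy
  simp only [map_sub, map_natCast, map_mul, map_pow] at this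
  exact ⟨_, this⟩

theorem IsTruncation.natCast_inj (hR : IsTruncation p k R) {e : ℕ} (he : e ≤ k) {s s' : ℕ}
    (hs : s < p ^ e) (hs' : s' < p ^ e) (h : (p : R) ^ e ∣ (s : R) - s') : s = s' := by
  have h1 := (hR.natCast_dvd_iff he ((s : ℤ) - s')).1 (by simpa using h)
  obtain ⟨d, hd⟩ := h1
  have h2 : ((s : ℤ)) ≡ s' [ZMOD ((p ^ e : ℕ) : ℤ)] :=
    (Int.modEq_iff_dvd.2 ⟨d, by push_cast; exact hd⟩ : (s' : ℤ) ≡ s [ZMOD _]).symm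
  have h3 := (Int.natCast_modEq_iff).1 h2
  rwa [Nat.ModEq, Nat.mod_eq_of_lt hs, Nat.mod_eq_of_lt hs'] at h3

theorem dens_vec_dvd [Finite R] (hR : IsTruncation p k R) (hk : 0 < k) (c : Fin m → R) :
    dens {x : Fin m → R | ∀ l, (p : R) ∣ x l - c l} = ((p : ℝ) ^ m)⁻¹ := by
  have h := dens_pi (ι := Fin m) (fun l => {x : R | (p : R) ∣ x - c l})
  have h1 : ∀ c : R, dens {x : R | (p : R) ∣ x - c} = (p : ℝ)⁻¹ := by
    intro c
    have : {x : R | (p : R) ∣ x - c} = Equiv.subRight c ⁻¹' {x | (p : R) ^ 1 ∣ x} := by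
      ext x; simp
    rw [this, dens_preimage_equiv, hR.dens_dvd hk, pow_one]
  simp only [h1, Finset.prod_const, Finset.card_univ, Fintype.card_fin, inv_pow] at h
  exact h

/-- The density of the pairs of vectors that are independent modulo `p`. -/
theorem dens_unimodular [Finite R] (hR : IsTruncation p k R) (hk : 0 < k) :
    dens {x : (Fin m → R) × (Fin m → R) | Unimodular x.1 x.2} =
      (1 - ((p : ℝ) ^ m)⁻¹) * (1 - p * ((p : ℝ) ^ m)⁻¹) := by
  have hnt : Nonempty R := ⟨0⟩
  set A : Set (Fin m → R) := {α | ∀ l, (p : R) ∣ α l} with hA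
  set S : Set ((Fin m → R) × (Fin m → R)) :=
    {x | x.1 ∈ Aᶜ ∧ ∀ l l', (p : R) ∣ x.1 l * x.2 l' - x.1 l' * x.2 l} with hS
  have hdA : dens A = ((p : ℝ) ^ m)⁻¹ := by
    simpa using dens_vec_dvd hR hk (0 : Fin m → R)
  have e : {x : (Fin m → R) × (Fin m → R) | Unimodular x.1 x.2} = (A ×ˢ Set.univ ∪ S)ᶜ := by
    ext x
    simp only [Unimodular, Set.mem_ofPred_eq, Set.mem_compl_iff, Set.mem_union, Set.mem_prod,
      Set.mem_univ, and_true, hS, not_or, not_and]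
    constructor
    · rintro h
      have hxA : x.1 ∉ A := by
        intro hx
        obtain ⟨l, hl⟩ := Unimodular.exists_isUnit hR hk h
        exact (hR.not_isUnit_iff hk _).2 (hx l) hl
      refine ⟨hxA, fun _ h' => ?_⟩
      obtain ⟨l, l', h⟩ := h
      exact (hR.not_isUnit_iff hk _).2 (h' l l') h
    · rintro ⟨h1, h2⟩
      have := h2 h1
      push Not at this
      obtain ⟨l, l', h⟩ := this
      exact ⟨l, l', by_contra fun hu => h ((hR.not_isUnit_iff hk _).1 hu)⟩
  have hdS : dens S = (p * ((p : ℝ) ^ m)⁻¹) * dens Aᶜ := by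
    refine dens_fiber ?_ ?_
    · intro α hα
      obtain ⟨l₀, hl₀⟩ : ∃ l, ¬ (p : R) ∣ α l := by
        simpa [hA] using hα
      have hu : IsUnit (α l₀) := by_contra fun hu => hl₀ ((hR.not_isUnit_iff hk _).1 hu)
      -- Given `α` nonzero modulo `p`, the dependent `β` are those congruent to `c α` for one of the
      -- `p` residues `c`, read off at a coordinate where `α` is a unit.
      have e2 : {β | (α, β) ∈ S} =
          ⋃ c ∈ Finset.range p, {β : Fin m → R | ∀ l, (p : R) ∣ β l - (fun l => (c : R) * α l) l} := by
        ext β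
        simp only [hS, Set.mem_ofPred_eq, Set.mem_iUnion, Finset.mem_range]
        constructor
        · rintro ⟨-, h⟩
          obtain ⟨v, hv⟩ := hu.exists_right_inv
          obtain ⟨c, hc, hcd⟩ := hR.exists_natCast (e := 1) (β l₀ * v)
          rw [pow_one] at hc hcd
          refine ⟨c, hc, fun l => ?_⟩
          have : β l - c * α l = v * (α l₀ * β l - α l * β l₀) + α l * (β l₀ * v - c) := by
            linear_combination -(β l) * hv
          rw [this]
          exact dvd_add ((h l₀ l).mul_left _) (hcd.mul_left _)
        · rintro ⟨c, -, h⟩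
          refine ⟨hα, fun l l' => ?_⟩
          have : α l * β l' - α l' * β l =
              α l * (β l' - c * α l') - α l' * (β l - c * α l) := by ring
          rw [this]
          exact dvd_sub ((h l').mul_left _) ((h l).mul_left _)
      rw [e2, dens_biUnion, Finset.sum_congr rfl fun c _ => dens_vec_dvd hR hk _]
      · simp
      · intro c hc c' hc' β h h'
        have h3 : (p : R) ∣ α l₀ * ((c : R) - c') := by
          have := dvd_sub (h' l₀) (h l₀)
          convert this using 1; ring
        rw [hu.dvd_mul_left] at h3
        exact hR.natCast_inj (e := 1) hk (by simpa using hc) (by simpa using hc') (by simpa using h3)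
    · intro α hα β h
      exact hα h.1
  rw [e, dens_compl, dens_union, dens_prod, dens_univ, hdS, dens_compl, hdA]
  · ring
  · rw [Set.disjoint_left]
    rintro x ⟨h, -⟩ h'
    exact h'.1 h

/-- The pairs of vectors `v` with `v₂ = p ^ i α`, `v₁ + s v₂ = p ^ j β`, `α` and `β` independent
modulo `p`. -/
def cell (p : ℕ) (m : ℕ) (R : Type*) [CommRing R] (i j s : ℕ) : Set ((Fin m → R) × (Fin m → R)) :=
  {v | ∃ α β : Fin m → R, Unimodular α β ∧ (∀ l, v.2 l = (p : R) ^ i * α l) ∧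
    ∀ l, v.1 l + s * v.2 l = (p : R) ^ j * β l}

/-- Up to a shear, the cell is the image of the independent pairs under multiplication by `(p ^ j, p
^ i)`, whose kernel has `p ^ (m (i + j))` elements. Since `i, j < k`, two pairs with the same image
agree modulo `p`, so the set of independent pairs is saturated. -/
theorem dens_cell [Finite R] (hR : IsTruncation p k R) {i j : ℕ} (hij : i ≤ j) (hj : j < k)
    (s : ℕ) : dens (cell p m R i j s) =
      (((p : ℝ) ^ m)⁻¹) ^ (i + j) * ((1 - ((p : ℝ) ^ m)⁻¹) * (1 - p * ((p : ℝ) ^ m)⁻¹)) := by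
  have hk : 0 < k := by omega
  have hp : (p : ℝ) ≠ 0 := by exact_mod_cast (Fact.out : p.Prime).ne_zero
  let f : (Fin m → R) × (Fin m → R) →+ (Fin m → R) × (Fin m → R) :=
    { toFun := fun x => (fun l => (p : R) ^ j * x.1 l, fun l => (p : R) ^ i * x.2 l)
      map_zero' := by ext <;> simp
      map_add' := fun x y => by ext <;> simp [mul_add] }
  let shear : (Fin m → R) × (Fin m → R) ≃ (Fin m → R) × (Fin m → R) :=
    { toFun := fun v => (fun l => v.1 l + s * v.2 l, v.2)
      invFun := fun v => (fun l => v.1 l - s * v.2 l, v.2)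
      left_inv := fun v => by ext <;> simp
      right_inv := fun v => by ext <;> simp }
  have e : cell p m R i j s = shear ⁻¹' (f '' {x | Unimodular x.1 x.2}) := by
    ext v
    constructor
    · rintro ⟨α, β, h, h1, h2⟩
      refine ⟨(β, α), h.symm, ?_⟩
      ext l
      · exact (h2 l).symm
      · exact (h1 l).symm
    · rintro ⟨⟨β, α⟩, h, h1⟩
      refine ⟨α, β, h.symm, fun l => ?_, fun l => ?_⟩
      · exact (congrFun (congrArg Prod.snd h1) l).symm
      · exact (congrFun (congrArg Prod.fst h1) l).symm
  have hker : Nat.card f.ker = p ^ (m * (i + j)) := by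
    have e2 : f.ker ≃ (Fin m → {x : R // (p : R) ^ j * x = 0}) ×
        (Fin m → {x : R // (p : R) ^ i * x = 0}) :=
      { toFun := fun x => (fun l => ⟨x.1.1 l, congrFun (congrArg Prod.fst x.2) l⟩,
          fun l => ⟨x.1.2 l, congrFun (congrArg Prod.snd x.2) l⟩)
        invFun := fun y => ⟨(fun l => y.1 l, fun l => y.2 l), by
          rw [AddMonoidHom.mem_ker]
          ext l
          · exact (y.1 l).2
          · exact (y.2 l).2⟩
        left_inv := fun _ => rfl
        right_inv := fun _ => rfl }
    rw [Nat.card_congr e2, Nat.card_prod, Nat.card_pi, Nat.card_pi]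
    simp only [hR.card_ker_mul hj.le, hR.card_ker_mul (hij.trans hj.le), Finset.prod_const,
      Finset.card_univ, Fintype.card_fin]
    rw [← pow_mul, ← pow_mul, ← pow_add]
    ring_nf
  have h := dens_image f (S := {x | Unimodular x.1 x.2}) (by
    intro x hx y hxy
    refine Unimodular.congr hR hk hx (fun l => ?_) (fun l => ?_)
    · exact hR.dvd_of_mul_eq_mul hj (congrFun (congrArg Prod.fst hxy) l)
    · exact hR.dvd_of_mul_eq_mul (hij.trans_lt hj) (congrFun (congrArg Prod.snd hxy) l))
  rw [e, dens_preimage_equiv, ← dens_unimodular hR hk, h, hker]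
  push_cast
  rw [pow_mul, inv_pow]
  have : ((p : ℝ) ^ m) ^ (i + j) ≠ 0 := pow_ne_zero _ (pow_ne_zero _ hp)
  field_simp

open Matrix in
/-- Over a pair `v` in a cell, the linear system for the other half of the coordinates. -/
theorem dens_fiber_cell [Finite R] (hR : IsTruncation p k R) {i j s : ℕ} (hij : i ≤ j)
    (hj : j ≤ k) {v : (Fin m → R) × (Fin m → R)} (hv : v ∈ cell p m R i j s) {w₁ w₂ w₃ : R}
    (h₁ : (p : R) ^ j ∣ w₁ + s * w₃ + s ^ 2 * w₂) (h₂ : (p : R) ^ i ∣ w₂)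
    (h₃ : (p : R) ^ i ∣ w₃ + 2 * s * w₂) :
    dens {u : (Fin m → R) × (Fin m → R) | u.1 ⬝ᵥ v.1 = w₁ ∧ u.2 ⬝ᵥ v.2 = w₂ ∧
      u.1 ⬝ᵥ v.2 + u.2 ⬝ᵥ v.1 = w₃} = (p : ℝ) ^ (2 * i + j) / (p : ℝ) ^ (3 * k) := by
  obtain ⟨α, β, ⟨l, l', hu⟩, hα, hβ⟩ := hv
  obtain ⟨d, rfl⟩ := Nat.exists_eq_add_of_le hij
  have hα' : v.2 = (p : R) ^ i • α := funext hα
  have hβ' : v.1 = (p : R) ^ (i + d) • β - (s : R) • v.2 := by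
    ext l; simp [← hβ l]
  -- After the substitution `v₁ ↦ v₁ + s v₂`, `u₁ ↦ u₁ + s u₂`, the three equations become `p ^ j`,
  -- `p ^ i` and `p ^ i` times the components of `F`. Since `α, β` are independent modulo `p`, these
  -- components take arbitrary values.
  let F : (Fin m → R) × (Fin m → R) →+ R × R × R :=
    { toFun := fun u => ((u.1 + (s : R) • u.2) ⬝ᵥ β, u.2 ⬝ᵥ α,
        (u.1 + (s : R) • u.2) ⬝ᵥ α + (p : R) ^ d * (u.2 ⬝ᵥ β))
      map_zero' := by simp
      map_add' := fun x y => by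
        simp only [Prod.fst_add, Prod.snd_add, add_dotProduct, smul_add, mul_add, Prod.mk_add_mk]
        congr 1 <;> [skip; congr 1] <;> ring }
  have hF : Function.Surjective F := by
    obtain ⟨c, hc⟩ := hu.exists_right_inv
    have key : ∀ a b : R, ∃ x : Fin m → R, x ⬝ᵥ α = a ∧ x ⬝ᵥ β = b := by
      intro a b
      refine ⟨(c * (a * β l' - b * α l')) • Pi.single l 1 +
        (c * (b * α l - a * β l)) • Pi.single l' 1, ?_, ?_⟩
      · simp only [add_dotProduct, smul_dotProduct, single_one_dotProduct, smul_eq_mul]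
        linear_combination a * hc
      · simp only [add_dotProduct, smul_dotProduct, single_one_dotProduct, smul_eq_mul]
        linear_combination b * hc
    rintro ⟨B, C, E⟩
    obtain ⟨y, hy1, hy2⟩ := key C 0
    obtain ⟨x, hx1, hx2⟩ := key E B
    refine ⟨(x - (s : R) • y, y), ?_⟩
    simp [F, hy1, hy2, hx1, hx2]
  have e : {u : (Fin m → R) × (Fin m → R) | u.1 ⬝ᵥ v.1 = w₁ ∧ u.2 ⬝ᵥ v.2 = w₂ ∧
      u.1 ⬝ᵥ v.2 + u.2 ⬝ᵥ v.1 = w₃} = F ⁻¹'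
      ({x | (p : R) ^ (i + d) * x = w₁ + s * w₃ + s ^ 2 * w₂} ×ˢ
        ({x | (p : R) ^ i * x = w₂} ×ˢ {x | (p : R) ^ i * x = w₃ + 2 * s * w₂})) := by
    ext u
    simp only [hβ', hα', Set.mem_ofPred_eq, Set.mem_preimage, Set.mem_prod, F, AddMonoidHom.coe_mk,
      ZeroHom.coe_mk, add_dotProduct, smul_dotProduct, dotProduct_sub, dotProduct_smul, smul_eq_mul]
    constructor
    · rintro ⟨h1, h2, h3⟩
      refine ⟨?_, ?_, ?_⟩
      · linear_combination h1 + s * h3 + s ^ 2 * h2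
      · linear_combination h2
      · rw [mul_add, ← mul_assoc ((p : R) ^ i), ← pow_add]
        linear_combination h3 + 2 * s * h2
    · rintro ⟨h1, h2, h3⟩
      rw [mul_add, ← mul_assoc ((p : R) ^ i), ← pow_add] at h3
      refine ⟨?_, ?_, ?_⟩
      · linear_combination h1 - s * h3 + s ^ 2 * h2
      · linear_combination h2
      · linear_combination h3 - 2 * s * h2
  rw [e, dens_preimage F hF, dens_prod, dens_prod, hR.dens_mul_eq hj h₁,
    hR.dens_mul_eq (hij.trans hj) h₂, hR.dens_mul_eq (hij.trans hj) h₃]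
  have hp : (p : ℝ) ≠ 0 := by exact_mod_cast (Fact.out : p.Prime).ne_zero
  field_simp
  ring

open Matrix in
theorem dvd_of_mem_cell {i j s : ℕ} (hij : i ≤ j) {v u : (Fin m → R) × (Fin m → R)}
    (hv : v ∈ cell p m R i j s) {w₁ w₂ w₃ : R} (h₁ : u.1 ⬝ᵥ v.1 = w₁) (h₂ : u.2 ⬝ᵥ v.2 = w₂)
    (h₃ : u.1 ⬝ᵥ v.2 + u.2 ⬝ᵥ v.1 = w₃) :
    (p : R) ^ j ∣ w₁ + s * w₃ + s ^ 2 * w₂ ∧ (p : R) ^ i ∣ w₂ ∧ (p : R) ^ i ∣ w₃ + 2 * s * w₂ := by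
  obtain ⟨α, β, -, hα, hβ⟩ := hv
  obtain ⟨d, rfl⟩ := Nat.exists_eq_add_of_le hij
  have hα' : v.2 = (p : R) ^ i • α := funext hα
  have hβ' : v.1 = (p : R) ^ (i + d) • β - (s : R) • v.2 := by
    ext l; simp [← hβ l]
  rw [← h₁, ← h₂, ← h₃, hβ', hα']
  simp only [dotProduct_sub, dotProduct_smul, smul_eq_mul]
  refine ⟨⟨u.1 ⬝ᵥ β + s * (u.2 ⬝ᵥ β), by ring⟩, ⟨_, rfl⟩,
    ⟨u.1 ⬝ᵥ α + p ^ d * (u.2 ⬝ᵥ β) + s * (u.2 ⬝ᵥ α), by ring⟩⟩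

theorem dvd_fst_of_mem_cell {i j s : ℕ} (hij : i ≤ j) {v : (Fin m → R) × (Fin m → R)}
    (hv : v ∈ cell p m R i j s) (l : Fin m) : (p : R) ^ i ∣ v.1 l := by
  obtain ⟨α, β, -, hα, hβ⟩ := hv
  have : v.1 l = (p : R) ^ j * β l - s * ((p : R) ^ i * α l) := by rw [← hβ, ← hα]; ring
  rw [this]
  exact dvd_sub ((pow_dvd_pow _ hij).mul_right _) (Dvd.intro _ rfl |>.mul_left _)

/-- In a cell the content of `v₂` is exactly `p ^ i`, because `α` has a unit coordinate. -/
theorem le_of_mem_cell (hR : IsTruncation p k R) {i j s e : ℕ} (hi : i < k)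
    {v : (Fin m → R) × (Fin m → R)} (hv : v ∈ cell p m R i j s) (h : ∀ l, (p : R) ^ e ∣ v.2 l) :
    e ≤ i := by
  obtain ⟨α, β, hu, hα, -⟩ := hv
  obtain ⟨l, hl⟩ := hu.exists_isUnit hR (by omega)
  by_contra! hie
  obtain ⟨y, hy⟩ := (pow_dvd_pow (p : R) (show i + 1 ≤ e from hie)).trans (h l)
  have := hR.dvd_of_mul_eq_mul hi (x := α l) (y := p * y) (by rw [← hα, hy]; ring)
  rw [dvd_sub_left (Dvd.intro _ rfl)] at this
  exact (hR.not_isUnit_iff (by omega) _).2 this hl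

/-- The content of `v₂` gives `i`. If another slope gave a larger `j'`, then `β` would be a multiple
of `α` modulo `p`, against independence. For equal `j`, the slopes agree modulo `p ^ (j - i)`, hence
are equal in the chosen range. -/
theorem cell_unique (hR : IsTruncation p k R) {i j s i' j' s' : ℕ} (hij : i ≤ j) (hj : j < k)
    (hs : s < p ^ (j - i)) (hij' : i' ≤ j') (hj' : j' < k) (hs' : s' < p ^ (j' - i'))
    {v : (Fin m → R) × (Fin m → R)} (hv : v ∈ cell p m R i j s) (hv' : v ∈ cell p m R i' j' s') :
    i = i' ∧ j = j' ∧ s = s' := by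
  have hi : i = i' := by
    refine le_antisymm (le_of_mem_cell hR (by omega) hv' fun l => ?_)
      (le_of_mem_cell hR (by omega) hv fun l => ?_)
    · obtain ⟨α, β, -, hα, -⟩ := hv
      exact ⟨_, hα l⟩
    · obtain ⟨α, β, -, hα, -⟩ := hv'
      exact ⟨_, hα l⟩
  subst hi
  have hk : 0 < k := by omega
  -- the difference of the slopes
  have slope : ∀ {j s j' s' : ℕ}, i ≤ j → j ≤ j' → v ∈ cell p m R i j s →
      v ∈ cell p m R i j' s' → ∃ e : R, (p : R) ^ i * (s - s') = p ^ j * e := by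
    rintro j s j' s' hij hjj ⟨α, β, hu, hα, hβ⟩ ⟨α', β', -, -, hβ'⟩
    obtain ⟨l, hl⟩ := hu.exists_isUnit hR hk
    obtain ⟨c, hc⟩ := hl.exists_right_inv
    obtain ⟨d, rfl⟩ := Nat.exists_eq_add_of_le hjj
    refine ⟨c * (β l - p ^ d * β' l), ?_⟩
    have h1 := hβ l
    have h2 := hβ' l
    rw [hα] at h1 h2
    rw [pow_add] at h2
    linear_combination c * h1 - c * h2 - (p : R) ^ i * (s - s') * hc
  have hlt : ∀ {j s j' s' : ℕ}, i ≤ j → j < k → v ∈ cell p m R i j s →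
      v ∈ cell p m R i j' s' → ¬ j < j' := by
    intro j s j' s' hij hj hv hv' hjj
    obtain ⟨e, he⟩ := slope hij hjj.le hv hv'
    obtain ⟨α, β, hu, hα, hβ⟩ := hv
    obtain ⟨α', β', -, -, hβ'⟩ := hv'
    obtain ⟨d, rfl⟩ := Nat.exists_eq_add_of_le (show j + 1 ≤ j' from hjj)
    have h : ∀ l, (p : R) ∣ β l - e * α l := by
      intro l
      have h1 := hβ l
      have h2 := hβ' l
      rw [hα] at h1 h2
      have h3 : (p : R) ^ j * β l = p ^ j * (e * α l + p * (p ^ d * β' l)) := by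
        rw [pow_add, pow_succ] at h2
        linear_combination -h1 + h2 + α l * he
      have h4 := hR.dvd_of_mul_eq_mul hj h3
      rw [← sub_sub, dvd_sub_left (Dvd.intro _ rfl)] at h4
      exact h4
    obtain ⟨l, l', hu⟩ := hu
    refine (hR.not_isUnit_iff hk _).2 ?_ hu
    have : α l * β l' - α l' * β l = α l * (β l' - e * α l') - α l' * (β l - e * α l) := by ring
    rw [this]
    exact dvd_sub ((h l').mul_left _) ((h l).mul_left _)
  have hjj : j = j' := le_antisymm (not_lt.1 (hlt hij' hj' hv' hv)) (not_lt.1 (hlt hij hj hv hv'))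
  subst hjj
  refine ⟨rfl, rfl, hR.natCast_inj (by omega) hs hs' ?_⟩
  obtain ⟨e, he⟩ := slope hij le_rfl hv hv'
  obtain ⟨d, rfl⟩ := Nat.exists_eq_add_of_le hij
  have := hR.dvd_of_mul_eq_zero (i := i) (by omega) (x := s - s' - p ^ d * e) (by
    rw [mul_sub, he, pow_add]; ring)
  rw [Nat.add_sub_cancel_left]
  have h2 := dvd_add ((pow_dvd_pow (p : R) (show d ≤ k - i by omega)).trans this) (Dvd.intro e rfl)
  simpa using h2

/-- In an unswapped cell the content of `v₂` divides `v₁`. In a swapped cell with `i' < j'` and `p ∣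
s'`, the content of `v₂` is strictly greater than that of `v₁`. -/
theorem not_mem_cell_of_swap (hR : IsTruncation p k R) {i j s i' j' s' : ℕ} (hij : i ≤ j)
    (hj : j < k) (hij' : i' < j') (hj' : j' < k) (hs' : p ∣ s')
    {v : (Fin m → R) × (Fin m → R)} (hv : v ∈ cell p m R i j s)
    (hv' : v.swap ∈ cell p m R i' j' s') : False := by
  have h1 : i ≤ i' := le_of_mem_cell hR (by omega) hv' fun l => dvd_fst_of_mem_cell hij hv l
  have h2 : i' + 1 ≤ i := by
    refine le_of_mem_cell hR (by omega) hv fun l => ?_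
    obtain ⟨α, β, -, hα, hβ⟩ := hv'
    obtain ⟨t, rfl⟩ := hs'
    have : v.2 l = (p : R) ^ j' * β l - (p * t : ℕ) * ((p : R) ^ i' * α l) := by
      rw [← hβ, ← hα]
      simp
    rw [this]
    refine dvd_sub ((pow_dvd_pow _ hij').mul_right _) ⟨t * α l, ?_⟩
    push_cast
    ring
  omega

/-- A pair of vectors `v` whose second member has content `p ^ i`, minimal, is degenerate or lies
in a cell. -/
theorem exists_mem_cell_of_dvd (hR : IsTruncation p k R) {i : ℕ} (hi : i < k)
    {v : (Fin m → R) × (Fin m → R)} (h1 : ∀ l, (p : R) ^ i ∣ v.1 l) {α : Fin m → R}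
    (hα : ∀ l, v.2 l = (p : R) ^ i * α l) {l₀ : Fin m} (hl₀ : IsUnit (α l₀)) :
    ∃ j s : ℕ, i ≤ j ∧ s < p ^ (j - i) ∧
      ((∀ l, (p : R) ^ (i + 1) ∣ v.1 l) → i < j ∧ p ∣ s) ∧
      ((∀ l, v.1 l + s * v.2 l = 0) ∨ j < k ∧ v ∈ cell p m R i j s) := by
  classical
  have hk : 0 < k := by omega
  -- Take the best approximation of `v₁` by multiples of `v₂`: the largest `j ≤ k` for which some
  -- slope works. If `j = k`, the pair is degenerate.
  let P : ℕ → Prop := fun j => ∃ s : R, ∀ l, (p : R) ^ j ∣ v.1 l + s * v.2 l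
  have hPi : P i := ⟨0, fun l => by simpa using h1 l⟩
  obtain ⟨j, hij, hjk, ⟨s, hs⟩, hmax⟩ : ∃ j, i ≤ j ∧ j ≤ k ∧ P j ∧ ∀ j', j < j' → j' ≤ k → ¬ P j' :=
    ⟨Nat.findGreatest P k, Nat.le_findGreatest hi.le hPi, Nat.findGreatest_le k,
      Nat.findGreatest_spec hi.le hPi, fun _ h h' => Nat.findGreatest_is_greatest h h'⟩
  obtain ⟨d, rfl⟩ := Nat.exists_eq_add_of_le hij
  obtain ⟨t, ht, e, he⟩ := hR.exists_natCast (e := d) s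
  choose β hβ using hs
  have hβ' : ∀ l, v.1 l + t * v.2 l = (p : R) ^ (i + d) * (β l - e * α l) := by
    intro l
    have := hβ l
    rw [hα] at this ⊢
    rw [pow_add] at this ⊢
    linear_combination this - (p : R) ^ i * α l * he
  refine ⟨i + d, t, hij, by simpa using ht, ?_, ?_⟩
  · intro h
    have hd : i < i + d := by
      by_contra hd
      exact hmax (i + 1) (by omega) (by omega) ⟨0, fun l => by simpa using h l⟩
    refine ⟨hd, ?_⟩
    obtain ⟨y, hy⟩ := h l₀
    obtain ⟨d', rfl⟩ := Nat.exists_eq_add_of_le (show 1 ≤ d by omega)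
    have h2 : (p : R) ^ i * (t * α l₀) = p ^ i * (p * (p ^ d' * (β l₀ - e * α l₀) - y)) := by
      have := hβ' l₀
      rw [hα, hy, pow_add, pow_add, pow_one] at this
      linear_combination this
    have h3 := hR.dvd_of_mul_eq_mul hi h2
    rw [dvd_sub_left (Dvd.intro _ rfl), hl₀.dvd_mul_right] at h3
    have := (hR.natCast_dvd_iff (j := 1) hk (t : ℤ)).1 (by simpa using h3)
    rw [pow_one] at this
    exact_mod_cast this
  · rcases hjk.eq_or_lt with hjk | hjk
    · left
      intro l
      rw [hβ', hjk, hR.pow_eq_zero, zero_mul]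
    · right
      refine ⟨hjk, α, fun l => β l - e * α l, ?_, hα, hβ'⟩
      by_contra hu
      have hminor : ∀ l, (p : R) ∣ α l₀ * β l - α l * β l₀ := by
        intro l
        rw [← hR.not_isUnit_iff hk]
        intro h
        exact hu ⟨l₀, l, by convert h using 1; ring⟩
      obtain ⟨c, hc⟩ := hl₀.exists_right_inv
      -- If `α, β` were dependent, then `β ≡ c β_{l₀} α` modulo `p`, and this corrected slope would
      -- gain a factor `p`, against the maximality of `j`.
      refine hmax (i + d + 1) (by omega) hjk ⟨s - c * β l₀ * p ^ d, fun l => ?_⟩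
      obtain ⟨y, hy⟩ := hminor l
      refine ⟨c * y, ?_⟩
      have := hβ l
      rw [hα] at this ⊢
      rw [pow_add] at this
      rw [pow_add, pow_add, pow_one]
      linear_combination this + (p : R) ^ i * p ^ d * c * hy - (p : R) ^ i * p ^ d * β l * hc

/-- Every pair of vectors over `ℤ_p / p ^ k` is degenerate or lies in a cell, up to a swap. -/
theorem exists_mem_cell (hR : IsTruncation p k R) (v : (Fin m → R) × (Fin m → R)) :
    (∃ s : ℕ, ∀ l, v.1 l + s * v.2 l = 0) ∨ (∃ s : ℕ, ∀ l, v.2 l + s * v.1 l = 0) ∨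
    (∃ i j s : ℕ, i ≤ j ∧ j < k ∧ s < p ^ (j - i) ∧ v ∈ cell p m R i j s) ∨
    (∃ i j s : ℕ, i < j ∧ j < k ∧ s < p ^ (j - i) ∧ p ∣ s ∧ v.swap ∈ cell p m R i j s) := by
  classical
  by_cases hv : ∀ l, v.1 l = 0 ∧ v.2 l = 0
  · exact Or.inl ⟨0, fun l => by simp [(hv l).1]⟩
  let P : ℕ → Prop := fun i => ∀ l, (p : R) ^ i ∣ v.1 l ∧ (p : R) ^ i ∣ v.2 l
  have hP0 : P 0 := fun l => by simp
  obtain ⟨i, hik, hi, hmax⟩ : ∃ i, i ≤ k ∧ P i ∧ ∀ i', i < i' → i' ≤ k → ¬ P i' :=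
    ⟨Nat.findGreatest P k, Nat.findGreatest_le k,
      Nat.findGreatest_spec (Nat.zero_le k) hP0, fun _ h h' => Nat.findGreatest_is_greatest h h'⟩
  have hik : i < k := by
    refine lt_of_le_of_ne hik ?_
    rintro rfl
    refine hv fun l => ?_
    have := hi l
    rwa [hR.pow_eq_zero, zero_dvd_iff, zero_dvd_iff] at this
  have hk : 0 < k := by omega
  choose γ hγ using fun l => (hi l).1
  choose α hα using fun l => (hi l).2
  have hnu : ∀ {w γ : Fin m → R}, (∀ l, w l = (p : R) ^ i * γ l) → (∀ l, ¬ IsUnit (γ l)) →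
      ∀ l, (p : R) ^ (i + 1) ∣ w l := by
    intro w γ hw h l
    obtain ⟨y, hy⟩ := (hR.not_isUnit_iff hk _).1 (h l)
    exact ⟨y, by rw [hw, hy]; ring⟩
  -- The vector of least content serves as second vector, with ties resolved in favour of `v₂`;
  -- hence the strict inequality and the condition `p ∣ s` in the swapped case.
  by_cases hu : ∃ l, IsUnit (α l)
  · obtain ⟨l₀, hl₀⟩ := hu
    obtain ⟨j, s, hij, hs, -, h | h⟩ := exists_mem_cell_of_dvd hR hik (fun l => (hi l).1) hα hl₀
    · exact Or.inl ⟨s, h⟩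
    · exact Or.inr (Or.inr (Or.inl ⟨i, j, s, hij, h.1, hs, h.2⟩))
  · push Not at hu
    have hdvd := hnu hα hu
    obtain ⟨l₀, hl₀⟩ : ∃ l, IsUnit (γ l) := by
      by_contra! h
      exact hmax (i + 1) (by omega) hik fun l => ⟨hnu hγ h l, hdvd l⟩
    obtain ⟨j, s, hij, hs, h1, h | h⟩ := exists_mem_cell_of_dvd hR hik (v := v.swap)
      (fun l => (hi l).2) hγ hl₀
    · exact Or.inr (Or.inl ⟨s, h⟩)
    · have := h1 hdvd
      exact Or.inr (Or.inr (Or.inr ⟨i, j, s, this.1, h.1, hs, this.2, h.2⟩))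

end Cell

/-! ### Counting solutions cell by cell. -/

section Solutions

variable {p : ℕ} [Fact p.Prime] {k m : ℕ} {R : Type*} [CommRing R] [Algebra ℤ_[p] R]

/-- As `c` has order one, the condition on `x ≠ 0` is `1 + 2 ord x ≥ e`, that is `ord x ≥ ⌊e / 2⌋`.
-/
theorem pow_dvd_mul_sq_iff {c n x : ℤ_[p]} (hn : IsUnit n) (hc : c = n * p) (e : ℕ) :
    (p : ℤ_[p]) ^ e ∣ c * x ^ 2 ↔ (p : ℤ_[p]) ^ (e / 2) ∣ x := by
  rw [hc, mul_assoc, hn.dvd_mul_left]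
  by_cases hx : x = 0
  · simp [hx]
  have hp : (p : ℤ_[p]) ≠ 0 := PadicInt.prime_p.ne_zero
  rw [← Ideal.mem_span_singleton, ← Ideal.mem_span_singleton,
    PadicInt.mem_span_pow_iff_le_valuation _ hx,
    PadicInt.mem_span_pow_iff_le_valuation _ (mul_ne_zero hp (pow_ne_zero _ hx)),
    PadicInt.valuation_mul hp (pow_ne_zero _ hx), PadicInt.valuation_pow, PadicInt.valuation_p]
  omega

open Matrix in
/-- The pairs of vectors of `⟨-c⟩ ⊕ H ^ m` with moment matrix `diag(t₁, t₂)`; a point is of the form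
`((v, a), u)`, with hyperbolic coordinates `u, v` and coordinates `a` in `⟨-c⟩`. -/
def solutions (m : ℕ) (c t₁ t₂ : R) :
    Set ((((Fin m → R) × (Fin m → R)) × (R × R)) × ((Fin m → R) × (Fin m → R))) :=
  {x | x.2.1 ⬝ᵥ x.1.1.1 = t₁ + c * x.1.2.1 ^ 2 ∧ x.2.2 ⬝ᵥ x.1.1.2 = t₂ + c * x.1.2.2 ^ 2 ∧
    x.2.1 ⬝ᵥ x.1.1.2 + x.2.2 ⬝ᵥ x.1.1.1 = 2 * c * x.1.2.1 * x.1.2.2}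

/-- The conditions on `T` and on the coordinates in `⟨-N⟩` over a given cell. -/
theorem dvd_conditions (hp : p ≠ 2) {c n t₁ t₂ : ℤ_[p]} (h : Anisotropic c t₁ t₂) (hn : IsUnit n)
    (hc : c = n * p) {i j s : ℕ} (hij : i ≤ j) (a₁ a₂ : ℤ_[p]) :
    ((p : ℤ_[p]) ^ j ∣ (t₁ + c * a₁ ^ 2) + s * (2 * c * a₁ * a₂) + s ^ 2 * (t₂ + c * a₂ ^ 2) ∧
      (p : ℤ_[p]) ^ i ∣ t₂ + c * a₂ ^ 2 ∧
      (p : ℤ_[p]) ^ i ∣ 2 * c * a₁ * a₂ + 2 * s * (t₂ + c * a₂ ^ 2)) ↔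
    ((p : ℤ_[p]) ^ j ∣ t₁ ∧ (p : ℤ_[p]) ^ j ∣ s ^ 2 * t₂ ∧ (p : ℤ_[p]) ^ i ∣ t₂) ∧
      (p : ℤ_[p]) ^ (j / 2) ∣ a₁ + s * a₂ ∧ (p : ℤ_[p]) ^ (i / 2) ∣ a₂ := by
  rw [← pow_dvd_mul_sq_iff hn hc, ← pow_dvd_mul_sq_iff hn hc]
  -- The combination is a value of the anisotropic form, so divisibility passes to its three terms
  -- separately.
  have e1 : (t₁ + c * a₁ ^ 2) + s * (2 * c * a₁ * a₂) + s ^ 2 * (t₂ + c * a₂ ^ 2) =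
      c * (a₁ + s * a₂) ^ 2 + t₁ * 1 ^ 2 + t₂ * s ^ 2 := by ring
  constructor
  · rintro ⟨h1, h2, -⟩
    rw [e1] at h1
    obtain ⟨g1, g2, g3⟩ := h.dvd hp h1
    obtain ⟨f1, -, f3⟩ := h.dvd hp (e := i) (x := a₂) (y := 0) (z := 1)
      (by convert h2 using 1; ring)
    exact ⟨⟨by simpa using g2, by rwa [mul_comm], by simpa using f3⟩, g1, f1⟩
  · rintro ⟨⟨h1, h2, h3⟩, h4, h5⟩
    refine ⟨?_, dvd_add h3 h5, ?_⟩
    · rw [e1]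
      exact dvd_add (dvd_add h4 (by simpa using h1)) (by rwa [mul_comm])
    -- The cross condition is automatic: this product has order at least `1 + ⌊j/2⌋ + ⌊i/2⌋`, and `i
    -- ≤ j` makes that at least `i`.
    · have h6 : (p : ℤ_[p]) ^ i ∣ c * (a₁ + s * a₂) * a₂ := by
        have h7 := (pow_dvd_mul_sq_iff hn hc _).1 h4
        have h8 := (pow_dvd_mul_sq_iff hn hc _).1 h5
        have h9 := mul_dvd_mul (mul_dvd_mul (Dvd.intro_left n hc.symm) h7) h8
        refine dvd_trans ?_ h9
        rw [← pow_succ', ← pow_add]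
        exact pow_dvd_pow _ (by omega)
      have e2 : 2 * c * a₁ * a₂ + 2 * s * (t₂ + c * a₂ ^ 2) =
          2 * (c * (a₁ + s * a₂) * a₂) + 2 * s * t₂ := by ring
      rw [e2]
      exact dvd_add (h6.mul_left _) (h3.mul_left _)

theorem dvd_conditions_map (hR : IsTruncation p k R) (hp : p ≠ 2) {c n t₁ t₂ : ℤ_[p]}
    (h : Anisotropic c t₁ t₂) (hn : IsUnit n) (hc : c = n * p) {i j s : ℕ} (hij : i ≤ j)
    (hj : j ≤ k) (a₁ a₂ : R) :
    ((p : R) ^ j ∣ (algebraMap ℤ_[p] R t₁ + algebraMap ℤ_[p] R c * a₁ ^ 2) +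
        s * (2 * algebraMap ℤ_[p] R c * a₁ * a₂) +
        s ^ 2 * (algebraMap ℤ_[p] R t₂ + algebraMap ℤ_[p] R c * a₂ ^ 2) ∧
      (p : R) ^ i ∣ algebraMap ℤ_[p] R t₂ + algebraMap ℤ_[p] R c * a₂ ^ 2 ∧
      (p : R) ^ i ∣ 2 * algebraMap ℤ_[p] R c * a₁ * a₂ +
        2 * s * (algebraMap ℤ_[p] R t₂ + algebraMap ℤ_[p] R c * a₂ ^ 2)) ↔
    ((p : ℤ_[p]) ^ j ∣ t₁ ∧ (p : ℤ_[p]) ^ j ∣ s ^ 2 * t₂ ∧ (p : ℤ_[p]) ^ i ∣ t₂) ∧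
      (p : R) ^ (j / 2) ∣ a₁ + s * a₂ ∧ (p : R) ^ (i / 2) ∣ a₂ := by
  obtain ⟨a₁, rfl⟩ := hR.surj a₁
  obtain ⟨a₂, rfl⟩ := hR.surj a₂
  have h := dvd_conditions hp h hn hc (s := s) hij a₁ a₂
  rw [← hR.dvd_iff hj, ← hR.dvd_iff (hij.trans hj), ← hR.dvd_iff (hij.trans hj),
    ← hR.dvd_iff ((Nat.div_le_self j 2).trans hj),
    ← hR.dvd_iff ((Nat.div_le_self i 2).trans (hij.trans hj))] at h
  simpa only [map_add, map_mul, map_pow, map_natCast, map_ofNat] using h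

/-- Product of three densities: that of the cell, that of the admissible `(a₁, a₂)`, and that of the
solutions `u` of the linear system, which is constant over them. The power `p ^ (2 i + j)` from the
linear system is split as `p ^ i * p ^ (i + j)` to produce the variable `p ^ (1 - m)`. -/
theorem dens_solutions_cell [Finite R] (hR : IsTruncation p k R) (hp : p ≠ 2) {c n t₁ t₂ : ℤ_[p]}
    (h : Anisotropic c t₁ t₂) (hn : IsUnit n) (hc : c = n * p) {i j s : ℕ} (hij : i ≤ j)
    (hj : j < k) (h1 : (p : ℤ_[p]) ^ j ∣ t₁) (h2 : (p : ℤ_[p]) ^ j ∣ s ^ 2 * t₂)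
    (h3 : (p : ℤ_[p]) ^ i ∣ t₂) :
    (p : ℝ) ^ (3 * k) * dens (solutions m (algebraMap ℤ_[p] R c) (algebraMap ℤ_[p] R t₁)
      (algebraMap ℤ_[p] R t₂) ∩ {x | x.1.1 ∈ cell p m R i j s}) =
    (p : ℝ) ^ i / ((p : ℝ) ^ (i / 2) * (p : ℝ) ^ (j / 2)) * (p * ((p : ℝ) ^ m)⁻¹) ^ (i + j) *
      ((1 - ((p : ℝ) ^ m)⁻¹) * (1 - p * ((p : ℝ) ^ m)⁻¹)) := by
  have hp0 : (p : ℝ) ≠ 0 := by exact_mod_cast (Fact.out : p.Prime).ne_zero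
  have hA : dens {a : R × R | (p : R) ^ (j / 2) ∣ a.1 + s * a.2 ∧ (p : R) ^ (i / 2) ∣ a.2} =
      ((p : ℝ) ^ (j / 2))⁻¹ * ((p : ℝ) ^ (i / 2))⁻¹ := by
    let shear : R × R ≃ R × R :=
      { toFun := fun v => (v.1 + s * v.2, v.2)
        invFun := fun v => (v.1 - s * v.2, v.2)
        left_inv := fun v => by ext <;> simp
        right_inv := fun v => by ext <;> simp }
    have e : {a : R × R | (p : R) ^ (j / 2) ∣ a.1 + s * a.2 ∧ (p : R) ^ (i / 2) ∣ a.2} =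
        shear ⁻¹' ({x | (p : R) ^ (j / 2) ∣ x} ×ˢ {x | (p : R) ^ (i / 2) ∣ x}) := by
      ext a; rfl
    rw [e, dens_preimage_equiv, dens_prod, hR.dens_dvd (by omega), hR.dens_dvd (by omega)]
  rw [dens_fiber (A := cell p m R i j s ×ˢ
      {a : R × R | (p : R) ^ (j / 2) ∣ a.1 + s * a.2 ∧ (p : R) ^ (i / 2) ∣ a.2})
      (c := (p : ℝ) ^ (2 * i + j) / (p : ℝ) ^ (3 * k)), dens_prod, dens_cell hR hij hj, hA]
  · field_simp
    ring
  · rintro ⟨v, a⟩ ⟨hv, ha⟩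
    obtain ⟨g1, g2, g3⟩ := (dvd_conditions_map hR hp h hn hc (s := s) hij hj.le a.1 a.2).2
      ⟨⟨h1, h2, h3⟩, ha⟩
    rw [← dens_fiber_cell hR hij hj.le hv g1 g2 g3]
    congr 1
    ext u
    exact ⟨fun hx => hx.1, fun hx => ⟨hx, hv⟩⟩
  · rintro ⟨v, a⟩ hva u ⟨hu, hv⟩
    have g := dvd_of_mem_cell hij hv hu.1 hu.2.1 hu.2.2
    exact hva ⟨hv, ((dvd_conditions_map hR hp h hn hc (s := s) hij hj.le a.1 a.2).1 g).2⟩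

variable (p) in
/-- The cells, of elementary divisors `p ^ i, p ^ j`, that contribute to the density. -/
def cellIndex₁ (a : ℕ) : Finset (Σ _ : ℕ, Σ _ : ℕ, ℕ) :=
  (Finset.range (a + 1)).sigma fun i => (Finset.Icc i a).sigma fun j => Finset.range (p ^ (j - i))

variable (p) in
/-- The swapped cells, of elementary divisors `p ^ i, p ^ j`, that contribute to the density. -/
def cellIndex₂ (a b : ℕ) : Finset (Σ _ : ℕ, Σ _ : ℕ, ℕ) :=
  (Finset.range (a + 1)).sigma fun i => (Finset.Ioc i b).sigma fun j =>
    (Finset.range (p ^ (j - i))).filter fun s => p ∣ s ∧ p ^ j ∣ s ^ 2 * p ^ a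

theorem mem_cellIndex₁ {a i j s : ℕ} :
    (⟨i, j, s⟩ : Σ _ : ℕ, Σ _ : ℕ, ℕ) ∈ cellIndex₁ p a ↔ i ≤ j ∧ j ≤ a ∧ s < p ^ (j - i) := by
  simp only [cellIndex₁, Finset.mem_sigma, Finset.mem_range, Finset.mem_Icc]
  omega

theorem mem_cellIndex₂ {a b i j s : ℕ} :
    (⟨i, j, s⟩ : Σ _ : ℕ, Σ _ : ℕ, ℕ) ∈ cellIndex₂ p a b ↔
      i ≤ a ∧ i < j ∧ j ≤ b ∧ s < p ^ (j - i) ∧ p ∣ s ∧ p ^ j ∣ s ^ 2 * p ^ a := by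
  simp only [cellIndex₂, Finset.mem_sigma, Finset.mem_range, Finset.mem_Ioc, Finset.mem_filter,
    Nat.lt_succ_iff]
  tauto

/-- The contribution of a cell of elementary divisors `p ^ i, p ^ j`. -/
noncomputable def cellWeight (p i j : ℕ) : ℝ :=
  (p : ℝ) ^ i / ((p : ℝ) ^ (i / 2) * (p : ℝ) ^ (j / 2))

/-- Interchanging the two vectors. -/
def swapVectors (W S : Type*) : ((W × W) × (S × S)) × (W × W) ≃ ((W × W) × (S × S)) × (W × W) where
  toFun x := ((x.1.1.swap, x.1.2.swap), x.2.swap)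
  invFun x := ((x.1.1.swap, x.1.2.swap), x.2.swap)
  left_inv _ := rfl
  right_inv _ := rfl

theorem swapVectors_mem_solutions {c t₁ t₂ : R}
    (x : (((Fin m → R) × (Fin m → R)) × (R × R)) × ((Fin m → R) × (Fin m → R))) :
    swapVectors _ _ x ∈ solutions m c t₂ t₁ ↔ x ∈ solutions m c t₁ t₂ := by
  simp only [solutions, swapVectors, Set.mem_ofPred_eq, Equiv.coe_fn_mk, Prod.fst_swap,
    Prod.snd_swap]
  constructor
  · rintro ⟨h1, h2, h3⟩
    exact ⟨h2, h1, by linear_combination h3⟩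
  · rintro ⟨h1, h2, h3⟩
    exact ⟨h2, h1, by linear_combination h3⟩

theorem pow_dvd_unit_mul_pow {u : ℤ_[p]} (hu : IsUnit u) {e a : ℕ} :
    (p : ℤ_[p]) ^ e ∣ u * p ^ a ↔ e ≤ a := by
  rw [hu.dvd_mul_left, pow_dvd_pow_iff PadicInt.prime_p.ne_zero PadicInt.prime_p.not_isUnit]

theorem pow_dvd_sq_mul_unit_mul_pow {u : ℤ_[p]} (hu : IsUnit u) {e a s : ℕ} :
    (p : ℤ_[p]) ^ e ∣ s ^ 2 * (u * p ^ a) ↔ p ^ e ∣ s ^ 2 * p ^ a := by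
  rw [mul_left_comm, hu.dvd_mul_left]
  have h := PadicInt.pow_p_dvd_int_iff (p := p) e ((s ^ 2 * p ^ a : ℕ) : ℤ)
  push_cast at h
  rw [h]
  exact_mod_cast Iff.rfl

open Matrix in
/-- A solution does not lie over a degenerate pair of vectors. -/
theorem not_degenerate (hR : IsTruncation p k R) (hp : p ≠ 2) {c t₁ t₂ : ℤ_[p]}
    (h : Anisotropic c t₁ t₂) (ht : ¬ (p : ℤ_[p]) ^ k ∣ t₁)
    {x : (((Fin m → R) × (Fin m → R)) × (R × R)) × ((Fin m → R) × (Fin m → R))}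
    (hx : x ∈ solutions m (algebraMap ℤ_[p] R c) (algebraMap ℤ_[p] R t₁) (algebraMap ℤ_[p] R t₂))
    (s : ℕ) : ¬ ∀ l, x.1.1.1 l + s * x.1.1.2 l = 0 := by
  intro hs
  have hs' : x.1.1.1 = -((s : R) • x.1.1.2) := by
    ext l
    simpa using eq_neg_of_add_eq_zero_left (hs l)
  obtain ⟨h1, h2, h3⟩ := hx
  rw [hs', dotProduct_neg, dotProduct_smul] at h1 h3
  obtain ⟨a₁, ha₁⟩ := hR.surj x.1.2.1
  obtain ⟨a₂, ha₂⟩ := hR.surj x.1.2.2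
  rw [← ha₁] at h1 h3
  rw [← ha₂] at h2 h3
  -- The vector `x₁ + s x₂` has vanishing `v`-half, so its hyperbolic part contributes nothing;
  -- anisotropy then forces `p ^ k ∣ t₁`.
  have : algebraMap ℤ_[p] R (c * (a₁ + s * a₂) ^ 2 + t₁ * 1 ^ 2 + t₂ * s ^ 2) = 0 := by
    simp only [map_add, map_mul, map_pow, map_natCast, map_one]
    simp only [smul_eq_mul] at h1 h3
    linear_combination -h1 - s * h3 - s ^ 2 * h2
  rw [hR.ker] at this
  exact ht (by simpa using (h.dvd hp this).2.1)

/-- The density of the solutions modulo `p ^ k`, `k` large. -/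
theorem dens_solutions [Finite R] (hR : IsTruncation p k R) (hp : p ≠ 2)
    {c n u₁ u₂ : ℤ_[p]} {a b : ℕ} (h : Anisotropic c (u₁ * p ^ a) (u₂ * p ^ b)) (hn : IsUnit n)
    (hc : c = n * p) (hu₁ : IsUnit u₁) (hu₂ : IsUnit u₂) (hab : a ≤ b) (hbk : b < k) :
    (p : ℝ) ^ (3 * k) * dens (solutions m (algebraMap ℤ_[p] R c)
      (algebraMap ℤ_[p] R (u₁ * p ^ a)) (algebraMap ℤ_[p] R (u₂ * p ^ b))) =
    (1 - ((p : ℝ) ^ m)⁻¹) * (1 - p * ((p : ℝ) ^ m)⁻¹) *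
      (∑ τ ∈ cellIndex₁ p a, cellWeight p τ.1 τ.2.1 * (p * ((p : ℝ) ^ m)⁻¹) ^ (τ.1 + τ.2.1) +
      ∑ τ ∈ cellIndex₂ p a b,
        cellWeight p τ.1 τ.2.1 * (p * ((p : ℝ) ^ m)⁻¹) ^ (τ.1 + τ.2.1)) := by
  set t₁ := u₁ * (p : ℤ_[p]) ^ a with ht₁
  set t₂ := u₂ * (p : ℤ_[p]) ^ b with ht₂
  set S := solutions m (algebraMap ℤ_[p] R c) (algebraMap ℤ_[p] R t₁) (algebraMap ℤ_[p] R t₂) with hS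
  set S' := solutions m (algebraMap ℤ_[p] R c) (algebraMap ℤ_[p] R t₂) (algebraMap ℤ_[p] R t₁)
    with hS'
  have hd1 : ∀ {e}, (p : ℤ_[p]) ^ e ∣ t₁ ↔ e ≤ a := fun {e} => pow_dvd_unit_mul_pow hu₁
  have hd2 : ∀ {e}, (p : ℤ_[p]) ^ e ∣ t₂ ↔ e ≤ b := fun {e} => pow_dvd_unit_mul_pow hu₂
  have hds : ∀ {e s : ℕ}, (p : ℤ_[p]) ^ e ∣ s ^ 2 * t₁ ↔ p ^ e ∣ s ^ 2 * p ^ a :=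
    fun {e s} => pow_dvd_sq_mul_unit_mul_pow hu₁
  let C₁ : (Σ _ : ℕ, Σ _ : ℕ, ℕ) →
      Set ((((Fin m → R) × (Fin m → R)) × (R × R)) × ((Fin m → R) × (Fin m → R))) :=
    fun τ => S ∩ {x | x.1.1 ∈ cell p m R τ.1 τ.2.1 τ.2.2}
  let C₂ : (Σ _ : ℕ, Σ _ : ℕ, ℕ) →
      Set ((((Fin m → R) × (Fin m → R)) × (R × R)) × ((Fin m → R) × (Fin m → R))) :=
    fun τ => S ∩ {x | x.1.1.swap ∈ cell p m R τ.1 τ.2.1 τ.2.2}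
  have hcond : ∀ {c t₁ t₂ : ℤ_[p]}, Anisotropic c t₁ t₂ → c = n * p → ∀ {i j s : ℕ}, i ≤ j → j ≤ k →
      ∀ {x : (((Fin m → R) × (Fin m → R)) × (R × R)) × ((Fin m → R) × (Fin m → R))},
      x ∈ solutions m (algebraMap ℤ_[p] R c) (algebraMap ℤ_[p] R t₁) (algebraMap ℤ_[p] R t₂) →
      x.1.1 ∈ cell p m R i j s →
      (p : ℤ_[p]) ^ j ∣ t₁ ∧ (p : ℤ_[p]) ^ j ∣ s ^ 2 * t₂ ∧ (p : ℤ_[p]) ^ i ∣ t₂ := by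
    intro c t₁ t₂ h hc i j s hij hj x hx hxc
    have g := dvd_of_mem_cell hij hxc hx.1 hx.2.1 hx.2.2
    exact ((dvd_conditions_map hR hp h hn hc (s := s) hij hj _ _).1 g).1
  have hcover : S = (⋃ τ ∈ cellIndex₁ p a, C₁ τ) ∪ ⋃ τ ∈ cellIndex₂ p a b, C₂ τ := by
    ext x
    constructor
    · intro hx
      have hx' : swapVectors _ _ x ∈ S' := (swapVectors_mem_solutions x).2 hx
      rcases exists_mem_cell hR x.1.1 with ⟨s, hs⟩ | ⟨s, hs⟩ | ⟨i, j, s, hij, hj, hs, hv⟩ |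
        ⟨i, j, s, hij, hj, hs, hps, hv⟩
      · exact absurd hs (not_degenerate hR hp h (by rw [hd1]; omega) hx s)
      · exact absurd hs (not_degenerate hR hp h.swap (by rw [hd2]; omega) hx' s)
      · left
        obtain ⟨g1, -, -⟩ := hcond h hc hij hj.le hx hv
        exact Set.mem_biUnion (mem_cellIndex₁.2 ⟨hij, hd1.1 g1, hs⟩)
          (show x ∈ C₁ ⟨i, j, s⟩ from ⟨hx, hv⟩)
      · right
        obtain ⟨g1, g2, g3⟩ := hcond h.swap hc hij.le hj.le hx' hv
        exact Set.mem_biUnion (mem_cellIndex₂.2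
          ⟨hd1.1 g3, hij, hd2.1 g1, hs, hps, hds.1 g2⟩) (show x ∈ C₂ ⟨i, j, s⟩ from ⟨hx, hv⟩)
    · rintro (hx | hx)
      · simp only [Set.mem_iUnion] at hx
        obtain ⟨_, _, hx⟩ := hx
        exact hx.1
      · simp only [Set.mem_iUnion] at hx
        obtain ⟨_, _, hx⟩ := hx
        exact hx.1
  have hw1 : ∀ τ ∈ cellIndex₁ p a, (p : ℝ) ^ (3 * k) * dens (C₁ τ) =
      (1 - ((p : ℝ) ^ m)⁻¹) * (1 - p * ((p : ℝ) ^ m)⁻¹) *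
      (cellWeight p τ.1 τ.2.1 * (p * ((p : ℝ) ^ m)⁻¹) ^ (τ.1 + τ.2.1)) := by
    rintro ⟨i, j, s⟩ hτ
    obtain ⟨hij, hj, -⟩ := mem_cellIndex₁.1 hτ
    rw [dens_solutions_cell hR hp h hn hc hij (by omega) (hd1.2 hj)
      (Dvd.dvd.mul_left (hd2.2 (hj.trans hab)) _) (hd2.2 (hij.trans (hj.trans hab))), cellWeight]
    ring
  have hw2 : ∀ τ ∈ cellIndex₂ p a b, (p : ℝ) ^ (3 * k) * dens (C₂ τ) =
      (1 - ((p : ℝ) ^ m)⁻¹) * (1 - p * ((p : ℝ) ^ m)⁻¹) *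
      (cellWeight p τ.1 τ.2.1 * (p * ((p : ℝ) ^ m)⁻¹) ^ (τ.1 + τ.2.1)) := by
    rintro ⟨i, j, s⟩ hτ
    obtain ⟨hi, hij, hj, -, -, hd⟩ := mem_cellIndex₂.1 hτ
    have e : C₂ ⟨i, j, s⟩ = swapVectors _ _ ⁻¹' (S' ∩ {x | x.1.1 ∈ cell p m R i j s}) := by
      ext x
      exact and_congr (swapVectors_mem_solutions x).symm Iff.rfl
    rw [e, dens_preimage_equiv, dens_solutions_cell hR hp h.swap hn hc hij.le (by omega) (hd2.2 hj)
      (hds.2 hd) (hd1.2 hi), cellWeight]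
    ring
  rw [hcover, dens_union, dens_biUnion, dens_biUnion, mul_add, Finset.mul_sum, Finset.mul_sum,
    Finset.sum_congr rfl hw1, Finset.sum_congr rfl hw2, ← Finset.mul_sum, ← Finset.mul_sum, mul_add]
  · rintro ⟨i, j, s⟩ hτ ⟨i', j', s'⟩ hτ' x hx hx'
    obtain ⟨-, hij, hj, hs, -, -⟩ := mem_cellIndex₂.1 hτ
    obtain ⟨-, hij', hj', hs', -, -⟩ := mem_cellIndex₂.1 hτ'
    obtain ⟨rfl, rfl, rfl⟩ := cell_unique hR hij.le (by omega) hs hij'.le (by omega) hs' hx.2 hx'.2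
    rfl
  · rintro ⟨i, j, s⟩ hτ ⟨i', j', s'⟩ hτ' x hx hx'
    obtain ⟨hij, hj, hs⟩ := mem_cellIndex₁.1 hτ
    obtain ⟨hij', hj', hs'⟩ := mem_cellIndex₁.1 hτ'
    obtain ⟨rfl, rfl, rfl⟩ := cell_unique hR hij (by omega) hs hij' (by omega) hs' hx.2 hx'.2
    rfl
  · rw [Set.disjoint_left]
    intro x hx hx'
    simp only [Set.mem_iUnion] at hx hx'
    obtain ⟨⟨i, j, s⟩, hτ, hx⟩ := hx
    obtain ⟨⟨i', j', s'⟩, hτ', hx'⟩ := hx'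
    obtain ⟨hij, hj, hs⟩ := mem_cellIndex₁.1 hτ
    obtain ⟨-, hij', hj', hs', hps', -⟩ := mem_cellIndex₂.1 hτ'
    exact not_mem_cell_of_swap hR hij (by omega) hij' (by omega) hps' hx.2 hx'.2

end Solutions

/-! ### From the lattice to coordinates modulo `p ^ k`. -/

noncomputable section Coordinates

open Matrix

variable {p : ℕ} [Fact p.Prime]

theorem finrank_traceless (p : ℕ) [Fact p.Prime] : Module.finrank ℚ_[p] (Traceless p) = 3 := by
  have h := LinearMap.finrank_range_add_finrank_ker (Matrix.traceLinearMap (Fin 2) ℚ_[p] ℚ_[p])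
  have h1 : LinearMap.range (Matrix.traceLinearMap (Fin 2) ℚ_[p] ℚ_[p]) = ⊤ := by
    rw [LinearMap.range_eq_top]
    exact fun x => ⟨!![x, 0; 0, 0], by simp [Matrix.trace_fin_two]⟩
  rw [h1, finrank_top, Module.finrank_self, Module.finrank_matrix] at h
  simp at h
  change 1 + Module.finrank ℚ_[p] (Traceless p) = 4 at h
  omega

/-- Coordinates on the lattice `L ⊕ H ^ r`. -/
def latticeEmbedding (p N r : ℕ) [Fact p.Prime] :
    ℤ_[p] × (Fin (r + 1) → ℤ_[p]) × (Fin (r + 1) → ℤ_[p]) →ₗ[ℤ_[p]]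
      Traceless p × ((Fin r → ℚ_[p]) × (Fin r → ℚ_[p])) where
  toFun z := (⟨!![(z.1 : ℚ_[p]), -(z.2.1 0 : ℚ_[p]) / N; (z.2.2 0 : ℚ_[p]), -(z.1 : ℚ_[p])], by
    simp [Matrix.trace_fin_two]⟩, (fun i => (z.2.1 i.succ : ℚ_[p]), fun i => (z.2.2 i.succ : ℚ_[p])))
  map_add' z w := by
    refine Prod.ext (Subtype.ext ?_) (Prod.ext ?_ ?_)
    · ext i j
      fin_cases i <;> fin_cases j <;> simp <;> ring
    · ext i; simp
    · ext i; simp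
  map_smul' c z := by
    refine Prod.ext (Subtype.ext ?_) (Prod.ext ?_ ?_)
    · change _ = (c : ℚ_[p]) • (!![(z.1 : ℚ_[p]), -(z.2.1 0 : ℚ_[p]) / N;
        (z.2.2 0 : ℚ_[p]), -(z.1 : ℚ_[p])] : Matrix (Fin 2) (Fin 2) ℚ_[p])
      ext i j
      fin_cases i <;> fin_cases j <;> simp <;> ring
    · ext i; simp [Algebra.smul_def]
    · ext i; simp [Algebra.smul_def]

theorem latticeEmbedding_injective {N r : ℕ} (hN : N ≠ 0) :
    Function.Injective (latticeEmbedding p N r) := by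
  have hN' : (N : ℚ_[p]) ≠ 0 := by exact_mod_cast hN
  rintro ⟨a, u, v⟩ ⟨a', u', v'⟩ h
  have h1 := congrArg (fun x => (x.1 : Matrix (Fin 2) (Fin 2) ℚ_[p])) h
  have h00 := congrFun (congrFun h1 0) 0
  have h01 := congrFun (congrFun h1 0) 1
  have h10 := congrFun (congrFun h1 1) 0
  have h2 := congrArg (fun x => x.2.1) h
  have h3 := congrArg (fun x => x.2.2) h
  simp [latticeEmbedding] at h00 h01 h10 h2 h3
  rw [div_left_inj' hN', neg_inj] at h01
  refine Prod.ext (Subtype.ext h00) (Prod.ext ?_ ?_)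
  · ext i
    refine Fin.cases ?_ (fun i => ?_) i
    · exact Subtype.ext h01
    · exact Subtype.ext (congrFun h2 i)
  · ext i
    refine Fin.cases ?_ (fun i => ?_) i
    · exact Subtype.ext h10
    · exact Subtype.ext (congrFun h3 i)

theorem range_latticeEmbedding (N r : ℕ) :
    LinearMap.range (latticeEmbedding p N r) =
      (levelLattice p N).prod (hyperbolicLattice p r) := by
  ext ⟨x, u, v⟩
  constructor
  · rintro ⟨⟨a, u', v'⟩, h⟩
    rw [← h]
    refine ⟨⟨a, -u' 0, v' 0, ?_⟩, fun i => ?_, fun i => ?_⟩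
    · simp [latticeEmbedding]
    · exact (u' i.succ).2
    · exact (v' i.succ).2
  · rintro ⟨⟨a, b, c, hx⟩, hu, hv⟩
    refine ⟨(a, Fin.cons (α := fun _ => ℤ_[p]) (-b) (fun i => (⟨u i, hu i⟩ : ℤ_[p])),
      Fin.cons (α := fun _ => ℤ_[p]) c (fun i => (⟨v i, hv i⟩ : ℤ_[p]))), ?_⟩
    refine Prod.ext (Subtype.ext ?_) (Prod.ext ?_ ?_)
    · simp only at hx
      rw [hx]
      have h : -((-b : ℤ_[p]) : ℚ_[p]) / N = b / N := by simp
      change (!![(a : ℚ_[p]), -((-b : ℤ_[p]) : ℚ_[p]) / N; (c : ℚ_[p]), -(a : ℚ_[p])] :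
        Matrix (Fin 2) (Fin 2) ℚ_[p]) = _
      rw [h]
    · rfl
    · rfl

/-- The polar form of `-c a² + u ⬝ v`. -/
def polarForm {S : Type*} [CommRing S] {m : ℕ} (c : S) (z w : S × (Fin m → S) × (Fin m → S)) : S :=
  -2 * c * z.1 * w.1 + z.2.1 ⬝ᵥ w.2.2 + w.2.1 ⬝ᵥ z.2.2

/-- The sign and the denominator in the upper right entry turn `N det` into `-N a² + u₀ v₀`: the
level lattice already contains one hyperbolic plane, hence `r + 1` coordinates in each half. -/
theorem polar_latticeEmbedding {N r : ℕ} (hN : N ≠ 0)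
    (z w : ℤ_[p] × (Fin (r + 1) → ℤ_[p]) × (Fin (r + 1) → ℤ_[p])) :
    QuadraticMap.polar ((levelForm p N).prod (hyperbolicForm p r)) (latticeEmbedding p N r z)
      (latticeEmbedding p N r w) = (polarForm (N : ℤ_[p]) z w : ℤ_[p]) := by
  have hN' : (N : ℚ_[p]) ≠ 0 := by exact_mod_cast hN
  have hQ : ∀ z : ℤ_[p] × (Fin (r + 1) → ℤ_[p]) × (Fin (r + 1) → ℤ_[p]),
      (levelForm p N).prod (hyperbolicForm p r) (latticeEmbedding p N r z) =
        ((-N * z.1 ^ 2 + z.2.1 ⬝ᵥ z.2.2 : ℤ_[p]) : ℚ_[p]) := by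
    intro z
    rw [QuadraticMap.prod_apply, levelForm_apply, hyperbolicForm_apply, dotProduct,
      Fin.sum_univ_succ]
    simp [latticeEmbedding, Matrix.det_fin_two]
    field_simp
    ring_nf
  rw [QuadraticMap.polar, ← map_add, hQ, hQ, hQ]
  norm_cast
  simp only [polarForm, Prod.fst_add, Prod.snd_add, add_dotProduct, dotProduct_add]
  ring_nf

variable {k : ℕ} {R : Type*} [CommRing R] [Algebra ℤ_[p] R]

variable (p R) in
/-- Reduction of the coordinates. -/
def reduction (m : ℕ) : ℤ_[p] × (Fin m → ℤ_[p]) × (Fin m → ℤ_[p]) →ₗ[ℤ_[p]]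
    R × (Fin m → R) × (Fin m → R) :=
  (Algebra.linearMap ℤ_[p] R).prodMap
    (((Algebra.linearMap ℤ_[p] R).compLeft (Fin m)).prodMap
      ((Algebra.linearMap ℤ_[p] R).compLeft (Fin m)))

theorem reduction_surjective (hR : IsTruncation p k R) (m : ℕ) :
    Function.Surjective (reduction p R m) := by
  rintro ⟨a, u, v⟩
  obtain ⟨a, rfl⟩ := hR.surj a
  choose u' hu using fun i => hR.surj (u i)
  choose v' hv using fun i => hR.surj (v i)
  exact ⟨(a, u', v'), Prod.ext rfl (Prod.ext (funext hu) (funext hv))⟩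

theorem reduction_eq_zero_iff (hR : IsTruncation p k R) {m : ℕ}
    (z : ℤ_[p] × (Fin m → ℤ_[p]) × (Fin m → ℤ_[p])) :
    reduction p R m z = 0 ↔ ∃ w, z = (p : ℤ_[p]) ^ k • w := by
  constructor
  · intro h
    obtain ⟨a, ha⟩ := (hR.ker _).1 (congrArg Prod.fst h)
    choose u hu using fun i => (hR.ker _).1 (congrFun (congrArg (fun x => x.2.1) h) i)
    choose v hv using fun i => (hR.ker _).1 (congrFun (congrArg (fun x => x.2.2) h) i)
    exact ⟨(a, u, v), Prod.ext ha (Prod.ext (funext hu) (funext hv))⟩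
  · rintro ⟨w, rfl⟩
    have h := (hR.ker _).2 (dvd_refl ((p : ℤ_[p]) ^ k))
    rw [map_smul, ← algebraMap_smul R, h, zero_smul]

theorem polarForm_reduction {m : ℕ} (c : ℤ_[p])
    (z w : ℤ_[p] × (Fin m → ℤ_[p]) × (Fin m → ℤ_[p])) :
    polarForm (algebraMap ℤ_[p] R c) (reduction p R m z) (reduction p R m w) =
      algebraMap ℤ_[p] R (polarForm c z w) := by
  simp [polarForm, reduction, dotProduct, map_ofNat (algebraMap ℤ_[p] R) 2]

/-- The vectors over `ℤ_p / p ^ k` whose moment matrix for `-c a² + u ⬝ v` is `T`. -/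
def momentSet (R : Type*) [CommRing R] [Algebra ℤ_[p] R] (m : ℕ) (c : ℤ_[p])
    (T : Matrix (Fin 2) (Fin 2) ℤ_[p]) :
    Set (Fin 2 → R × (Fin m → R) × (Fin m → R)) :=
  {x | ∀ i j, polarForm (algebraMap ℤ_[p] R c) (x i) (x j) = algebraMap ℤ_[p] R (2 * T i j)}

/-- Coordinates identify `L / p ^ k L` with vectors over `R`. Since `2` is a unit, the congruence
for the moment matrix can be doubled, which removes the factor `1 / 2` and makes it an equation of
polar forms over `R`. -/
theorem ncard_repSet_eq {V : Type*} [AddCommGroup V] [Module ℚ_[p] V] [Module ℤ_[p] V]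
    [IsScalarTower ℤ_[p] ℚ_[p] V] (hR : IsTruncation p k R) (hp : p ≠ 2) {m : ℕ} {c₀ : ℤ_[p]}
    {Q : QuadraticForm ℚ_[p] V} {L : Submodule ℤ_[p] V}
    {ι : ℤ_[p] × (Fin m → ℤ_[p]) × (Fin m → ℤ_[p]) →ₗ[ℤ_[p]] V} (hι : Function.Injective ι)
    (hL : LinearMap.range ι = L)
    (hQ : ∀ z w, QuadraticMap.polar Q (ι z) (ι w) = (polarForm c₀ z w : ℤ_[p]))
    (T : Matrix (Fin 2) (Fin 2) ℤ_[p]) :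
    (repSet Q L T k).ncard = (momentSet R m c₀ T).ncard := by
  have hmem : ∀ z, ι z ∈ L := fun z => by
    rw [← hL]; exact ⟨z, rfl⟩
  let E : (ℤ_[p] × (Fin m → ℤ_[p]) × (Fin m → ℤ_[p])) ≃ₗ[ℤ_[p]] L :=
    LinearEquiv.ofBijective ((ι).codRestrict L hmem) (by
      constructor
      · intro z w h
        exact hι (congrArg Subtype.val h)
      · rintro ⟨x, hx⟩
        have hx' := hx
        rw [← hL] at hx'
        obtain ⟨z, rfl⟩ := hx'
        exact ⟨z, rfl⟩)
  have hE : ∀ z, ((E z : L) : V) =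
    ι z := fun _ => rfl
  let c : L →ₗ[ℤ_[p]] R × (Fin m → R) × (Fin m → R) :=
    (reduction p R m).comp E.symm.toLinearMap
  have hcE : ∀ z, c (E z) = reduction p R m z := fun z => by simp [c]
  have hsurj : Function.Surjective c := (reduction_surjective hR _).comp E.symm.surjective
  have hker : Ideal.span {(p : ℤ_[p]) ^ k} • (⊤ : Submodule ℤ_[p] L) = LinearMap.ker c := by
    ext x
    obtain ⟨z, rfl⟩ := E.surjective x
    rw [Submodule.ideal_span_singleton_smul, Submodule.mem_smul_pointwise_iff_exists,
      LinearMap.mem_ker, hcE, reduction_eq_zero_iff hR]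
    constructor
    · rintro ⟨y, -, hy⟩
      refine ⟨E.symm y, E.injective ?_⟩
      rw [map_smul, E.apply_symm_apply, hy]
    · rintro ⟨w, rfl⟩
      exact ⟨E w, trivial, (map_smul E _ _).symm⟩
  let Φ : (L ⧸ (Ideal.span {(p : ℤ_[p]) ^ k} • (⊤ : Submodule ℤ_[p] L))) ≃
      R × (Fin m → R) × (Fin m → R) :=
    ((Submodule.quotEquivOfEq _ _ hker).trans (c.quotKerEquivOfSurjective hsurj)).toEquiv
  have hΦ : ∀ y : L, Φ (Submodule.Quotient.mk y) = c y := fun y => rfl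
  let Ψ : (Fin 2 → L ⧸ (Ideal.span {(p : ℤ_[p]) ^ k} • (⊤ : Submodule ℤ_[p] L))) ≃
      (Fin 2 → R × (Fin m → R) × (Fin m → R)) := Equiv.arrowCongr (Equiv.refl _) Φ
  have h2 : (2 : ℚ_[p]) ≠ 0 := two_ne_zero
  have h2' : ((2 : ℤ_[p]) : ℚ_[p]) = 2 := rfl
  have hcond : ∀ (y : Fin 2 → L) (i j : Fin 2), (∃ z : ℤ_[p],
      momentMatrix Q
        (fun l => (y l : V)) i j
        - (T i j : ℚ_[p]) = (p : ℚ_[p]) ^ k * (z : ℚ_[p])) ↔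
      polarForm (algebraMap ℤ_[p] R c₀) (c (y i)) (c (y j)) = algebraMap ℤ_[p] R (2 * T i j) := by
    intro y i j
    obtain ⟨zi, hzi⟩ := E.surjective (y i)
    obtain ⟨zj, hzj⟩ := E.surjective (y j)
    rw [momentMatrix, Matrix.of_apply, ← hzi, ← hzj, hE, hE, hQ, hcE, hcE,
      polarForm_reduction, ← sub_eq_zero (a := algebraMap ℤ_[p] R _), ← map_sub, hR.ker]
    constructor
    · rintro ⟨z, hz⟩
      refine ⟨2 * z, PadicInt.ext ?_⟩
      push_cast
      rw [h2']
      linear_combination 2 * hz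
    · rintro ⟨z, hz⟩
      obtain ⟨t, ht⟩ := (isUnit_two hp).exists_right_inv
      refine ⟨t * z, ?_⟩
      have hz' := congrArg (fun x : ℤ_[p] => (x : ℚ_[p])) hz
      have ht' := congrArg (fun x : ℤ_[p] => (x : ℚ_[p])) ht
      push_cast at hz' ht' ⊢
      rw [h2'] at hz' ht'
      linear_combination (1 / 2) * hz' - (1 / 2) * (p : ℚ_[p]) ^ k * z * ht'
  have e : repSet Q L T k =
      Ψ ⁻¹' momentSet R m c₀ T := by
    ext x
    constructor
    · rintro ⟨y, hy, hy'⟩ i j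
      have hi : Ψ x i = c (y i) := by rw [← hΦ, hy]; rfl
      have hj : Ψ x j = c (y j) := by rw [← hΦ, hy]; rfl
      rw [hi, hj]
      exact (hcond y i j).1 (hy' i j)
    · intro h
      choose y hy using fun i => Submodule.Quotient.mk_surjective _ (x i)
      refine ⟨y, hy, fun i j => (hcond y i j).2 ?_⟩
      have hi : Ψ x i = c (y i) := by rw [← hΦ, hy]; rfl
      have hj : Ψ x j = c (y j) := by rw [← hΦ, hy]; rfl
      rw [← hi, ← hj]
      exact h i j
  rw [e, Set.ncard_preimage_of_injective_subset_range Ψ.injective (by simp)]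

theorem ncard_repSet (hR : IsTruncation p k R) (hp : p ≠ 2) {N : ℕ} (hN : N ≠ 0) (r : ℕ)
    (T : Matrix (Fin 2) (Fin 2) ℤ_[p]) :
    (repSet ((levelForm p N).prod (hyperbolicForm p r))
      ((levelLattice p N).prod (hyperbolicLattice p r)) T k).ncard =
    (momentSet R (r + 1) (N : ℤ_[p]) T).ncard :=
  ncard_repSet_eq hR hp (latticeEmbedding_injective hN) (range_latticeEmbedding N r)
    (polar_latticeEmbedding hN) T

/-- The action of `2 × 2` matrices on pairs of vectors. -/
def actVectors {S M : Type*} [CommRing S] [AddCommGroup M] [Module S M]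
    (G : Matrix (Fin 2) (Fin 2) S) (x : Fin 2 → M) : Fin 2 → M :=
  fun j => G 0 j • x 0 + G 1 j • x 1

theorem actVectors_actVectors {S M : Type*} [CommRing S] [AddCommGroup M] [Module S M]
    {G G' : Matrix (Fin 2) (Fin 2) S} (h : G * G' = 1) (x : Fin 2 → M) :
    actVectors G' (actVectors G x) = x := by
  have g : ∀ i j, (G * G') i j = (1 : Matrix (Fin 2) (Fin 2) S) i j := fun i j => by rw [h]
  simp only [Matrix.mul_apply, Fin.sum_univ_two] at g
  have key : ∀ j, actVectors G' (actVectors G x) j =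
      (G 0 0 * G' 0 j + G 0 1 * G' 1 j) • x 0 + (G 1 0 * G' 0 j + G 1 1 * G' 1 j) • x 1 := by
    intro j
    simp only [actVectors]
    module
  ext j
  rw [key, g, g]
  fin_cases j <;> simp [Matrix.one_apply]

theorem polarForm_actVectors {m : ℕ} (c : ℤ_[p]) (G : Matrix (Fin 2) (Fin 2) ℤ_[p])
    (x : Fin 2 → R × (Fin m → R) × (Fin m → R)) (i j : Fin 2) :
    polarForm (algebraMap ℤ_[p] R c) (actVectors G x i) (actVectors G x j) =
      algebraMap ℤ_[p] R (G 0 i * G 0 j) * polarForm (algebraMap ℤ_[p] R c) (x 0) (x 0) +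
      algebraMap ℤ_[p] R (G 0 i * G 1 j) * polarForm (algebraMap ℤ_[p] R c) (x 0) (x 1) +
      algebraMap ℤ_[p] R (G 1 i * G 0 j) * polarForm (algebraMap ℤ_[p] R c) (x 1) (x 0) +
      algebraMap ℤ_[p] R (G 1 i * G 1 j) * polarForm (algebraMap ℤ_[p] R c) (x 1) (x 1) := by
  simp only [actVectors, polarForm, Prod.fst_add, Prod.snd_add, Prod.smul_fst, Prod.smul_snd,
    add_dotProduct, dotProduct_add, smul_dotProduct, dotProduct_smul]
  simp only [Algebra.smul_def, map_mul]
  ring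

theorem actVectors_mem_momentSet {m : ℕ} {c : ℤ_[p]} {T G : Matrix (Fin 2) (Fin 2) ℤ_[p]}
    {x : Fin 2 → R × (Fin m → R) × (Fin m → R)} (hx : x ∈ momentSet R m c T) :
    actVectors G x ∈ momentSet R m c (G.transpose * T * G) := by
  intro i j
  rw [polarForm_actVectors, hx, hx, hx, hx]
  simp only [← map_mul, ← map_add, Matrix.mul_apply, Fin.sum_univ_two, Matrix.transpose_apply]
  congr 1
  ring

/-- The invertible change of basis `G` permutes the pairs of vectors and carries moment matrix `D`
to `Gᵗ D G`. -/
theorem dens_momentSet {m : ℕ} {c : ℤ_[p]} {T D G G' : Matrix (Fin 2) (Fin 2) ℤ_[p]}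
    (h : G * G' = 1) (h' : G' * G = 1) (hT : T = G.transpose * D * G) :
    dens (momentSet R m c T) = dens (momentSet R m c D) := by
  let e : (Fin 2 → R × (Fin m → R) × (Fin m → R)) ≃ (Fin 2 → R × (Fin m → R) × (Fin m → R)) :=
    ⟨actVectors G, actVectors G', actVectors_actVectors h, actVectors_actVectors h'⟩
  rw [← dens_preimage_equiv e]
  congr 1
  ext x
  constructor
  · intro hx
    have := actVectors_mem_momentSet (G := G') hx
    rw [hT] at this
    have e2 : G'.transpose * (G.transpose * D * G) * G' = D := by
      calc G'.transpose * (G.transpose * D * G) * G'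
          = (G * G').transpose * D * (G * G') := by
            simp only [Matrix.transpose_mul, Matrix.mul_assoc]
        _ = D := by rw [h]; simp
    rw [e2] at this
    have e3 : actVectors G' (e x) = x := e.symm_apply_apply x
    rwa [← e3]
  · intro hx
    have := actVectors_mem_momentSet (G := G) hx
    rwa [← hT] at this

theorem dens_momentSet_diagonal (hp : p ≠ 2) {m : ℕ} (c t₁ t₂ : ℤ_[p]) :
    dens (momentSet R m c !![t₁, 0; 0, t₂]) =
      dens (solutions m (algebraMap ℤ_[p] R c) (algebraMap ℤ_[p] R t₁) (algebraMap ℤ_[p] R t₂)) := by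
  have hm : algebraMap ℤ_[p] R 2 = 2 := map_ofNat _ 2
  have hu : IsUnit (2 : R) := hm ▸ (isUnit_two hp).map (algebraMap ℤ_[p] R)
  let e : (Fin 2 → R × (Fin m → R) × (Fin m → R)) ≃
      ((((Fin m → R) × (Fin m → R)) × (R × R)) × ((Fin m → R) × (Fin m → R))) :=
    { toFun := fun x => ((((x 0).2.2, (x 1).2.2), ((x 0).1, (x 1).1)), ((x 0).2.1, (x 1).2.1))
      invFun := fun y => ![(y.1.2.1, y.2.1, y.1.1.1), (y.1.2.2, y.2.2, y.1.1.2)]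
      left_inv := fun x => by ext i <;> fin_cases i <;> rfl
      right_inv := fun y => rfl }
  rw [← dens_preimage_equiv e]
  congr 1
  ext x
  simp only [momentSet, Set.mem_ofPred_eq, Set.mem_preimage, solutions, e]
  constructor
  · intro h
    have h00 := h 0 0
    have h01 := h 0 1
    have h11 := h 1 1
    simp [polarForm, hm] at h00 h01 h11
    refine ⟨hu.mul_left_cancel ?_, hu.mul_left_cancel ?_, ?_⟩
    · linear_combination h00
    · linear_combination h11
    · linear_combination h01
  · rintro ⟨h1, h2, h3⟩ i j
    fin_cases i <;> fin_cases j <;> simp [polarForm, hm]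
    · linear_combination 2 * h1
    · linear_combination h3
    · linear_combination h3
    · linear_combination 2 * h2

/-- The ambient set has `p ^ (2 k (3 + 2 r))` elements, so the normalised count in the limit is `p ^
(3 k)` times a proportion; the sequence is eventually constant. -/
theorem isRepDensity_of_eventually (hp : p ≠ 2) {N : ℕ} (hN : N ≠ 0) (r : ℕ)
    {T D G G' : Matrix (Fin 2) (Fin 2) ℤ_[p]} {t₁ t₂ : ℤ_[p]}
    (h : G * G' = 1) (h' : G' * G = 1) (hD : D = !![t₁, 0; 0, t₂]) (hT : T = G.transpose * D * G)
    {α : ℝ} {K : ℕ} (hα : ∀ k, K ≤ k → (p : ℝ) ^ (3 * k) * dens (solutions (r + 1)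
      (algebraMap ℤ_[p] (ℤ_[p] ⧸ Ideal.span {(p : ℤ_[p]) ^ k}) N)
      (algebraMap ℤ_[p] _ t₁) (algebraMap ℤ_[p] _ t₂)) = α) :
    IsRepDensity ((levelForm p N).prod (hyperbolicForm p r))
      ((levelLattice p N).prod (hyperbolicLattice p r)) T α := by
  refine tendsto_const_nhds.congr' ?_
  filter_upwards [eventually_ge_atTop K] with k hk
  have hR := isTruncation_quotient p k
  have := finite_quotient p k
  rw [← hα k hk, ← dens_momentSet_diagonal hp, ← hD, ← dens_momentSet h h' hT, dens,
    ncard_repSet hR hp hN]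
  have hcard : Nat.card (Fin 2 → (ℤ_[p] ⧸ Ideal.span {(p : ℤ_[p]) ^ k}) ×
      (Fin (r + 1) → ℤ_[p] ⧸ Ideal.span {(p : ℤ_[p]) ^ k}) ×
      (Fin (r + 1) → ℤ_[p] ⧸ Ideal.span {(p : ℤ_[p]) ^ k})) = (p ^ k) ^ ((3 + (r + r)) * 2) := by
    rw [Nat.card_fun, Nat.card_prod, Nat.card_prod, Nat.card_fun, hR.card]
    simp only [Nat.card_fin]
    ring
  have hrank : Module.finrank ℚ_[p] (Traceless p × ((Fin r → ℚ_[p]) × (Fin r → ℚ_[p]))) =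
      3 + (r + r) := by
    rw [Module.finrank_prod, finrank_traceless, Module.finrank_prod, Module.finrank_fin_fun]
  rw [hcard, hrank]
  push_cast
  rw [pow_mul']
  ring_nf

end Coordinates

/-! ### Evaluation of the sum of the weights. -/

section Sums

theorem pow_dvd_sq_iff {p : ℕ} (hp : p.Prime) (n s : ℕ) : p ^ n ∣ s ^ 2 ↔ p ^ ((n + 1) / 2) ∣ s := by
  by_cases hs : s = 0
  · simp [hs]
  rw [hp.pow_dvd_iff_le_factorization (pow_ne_zero 2 hs), hp.pow_dvd_iff_le_factorization hs,
    Nat.factorization_pow]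
  simp
  omega

theorem card_filter_pow_dvd {p : ℕ} (hp : 0 < p) {n e : ℕ} (h : e ≤ n) :
    ((Finset.range (p ^ n)).filter fun s => p ^ e ∣ s).card = p ^ (n - e) := by
  have : (Finset.range (p ^ n)).filter (fun s => p ^ e ∣ s) =
      (Finset.range (p ^ (n - e))).image fun t => p ^ e * t := by
    ext s
    simp only [Finset.mem_filter, Finset.mem_range, Finset.mem_image]
    have hpe : p ^ n = p ^ e * p ^ (n - e) := by rw [← pow_add, Nat.add_sub_cancel' h]
    constructor
    · rintro ⟨h1, t, rfl⟩
      rw [hpe] at h1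
      exact ⟨t, Nat.lt_of_mul_lt_mul_left h1, rfl⟩
    · rintro ⟨t, ht, rfl⟩
      rw [hpe]
      exact ⟨Nat.mul_lt_mul_of_pos_left ht (pow_pos hp e), Dvd.intro _ rfl⟩
  rw [this, Finset.card_image_of_injective, Finset.card_range]
  exact fun x y hxy => Nat.eq_of_mul_eq_mul_left (pow_pos hp e) hxy

/-- Both conditions say that `s` is divisible by a power of `p`, with exponents `1` and `⌈(j - a) /
2⌉` (truncated subtraction); the larger one decides. -/
theorem card_slopes {p : ℕ} (hp : p.Prime) {a i j : ℕ} (hi : i ≤ a) (hij : i < j) :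
    ((Finset.range (p ^ (j - i))).filter fun s => p ∣ s ∧ p ^ j ∣ s ^ 2 * p ^ a).card =
      p ^ (j - i - max 1 ((j - a + 1) / 2)) := by
  rw [← card_filter_pow_dvd hp.pos (show max 1 ((j - a + 1) / 2) ≤ j - i by omega)]
  congr 1
  refine Finset.filter_congr fun s _ => ?_
  have h1 : p ^ j ∣ s ^ 2 * p ^ a ↔ p ^ (j - a) ∣ s ^ 2 := by
    rcases le_total j a with h | h
    · rw [Nat.sub_eq_zero_of_le h]
      simpa using Dvd.dvd.mul_left (pow_dvd_pow p h) _
    · obtain ⟨d, rfl⟩ := Nat.exists_eq_add_of_le h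
      rw [Nat.add_sub_cancel_left, pow_add, mul_comm (p ^ a),
        Nat.mul_dvd_mul_iff_right (pow_pos hp.pos a)]
  rw [h1, pow_dvd_sq_iff hp]
  rcases le_total 1 ((j - a + 1) / 2) with h | h
  · rw [max_eq_right h]
    exact ⟨fun h' => h'.2, fun h' => ⟨(dvd_pow_self p (by omega)).trans h', h'⟩⟩
  · rw [max_eq_left h, pow_one]
    exact ⟨fun h' => h'.1, fun h' => ⟨h', (pow_dvd_pow p h).trans (by simpa using h')⟩⟩

theorem pow_mul_cellWeight {p : ℕ} (hp : p ≠ 0) {i j e : ℕ} (hij : i ≤ j)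
    (he : e ≤ j - i) (he' : e + i / 2 + j / 2 ≤ j) :
    ((p ^ (j - i - e) : ℕ) : ℝ) * cellWeight p i j = (p : ℝ) ^ (j - j / 2 - e - i / 2) := by
  have hp' : (p : ℝ) ≠ 0 := by exact_mod_cast hp
  rw [cellWeight, ← mul_div_assoc, div_eq_iff (by positivity)]
  push_cast
  rw [← pow_add, ← pow_add, ← pow_add]
  congr 1
  omega

theorem sum_cellIndex₁ {p : ℕ} (hp : p ≠ 0) (a : ℕ) :
    ∑ τ ∈ cellIndex₁ p a, cellWeight p τ.1 τ.2.1 =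
      ∑ j ∈ Finset.range (a + 1), ∑ i ∈ Finset.range (j + 1), (p : ℝ) ^ (j - j / 2 - i / 2) := by
  rw [cellIndex₁, Finset.sum_sigma,
    Finset.sum_comm' (t' := Finset.range (a + 1)) (s' := fun j => Finset.range (j + 1))
      (s := Finset.range (a + 1)) (t := fun i => Finset.Icc i a) (f := fun i j => _)
      (by simp only [Finset.mem_range, Finset.mem_Icc]; omega) |>.symm]
  refine Finset.sum_congr rfl fun i _ => ?_
  rw [Finset.sum_sigma]
  refine Finset.sum_congr rfl fun j hj => ?_
  have hij := (Finset.mem_Icc.1 hj).1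
  dsimp only
  rw [Finset.sum_const, Finset.card_range, nsmul_eq_mul]
  have := pow_mul_cellWeight hp hij (e := 0) (by omega) (by omega)
  simpa using this

theorem sum_cellIndex₂ {p : ℕ} (hp : p.Prime) (a b : ℕ) :
    ∑ τ ∈ cellIndex₂ p a b, cellWeight p τ.1 τ.2.1 =
      ∑ j ∈ Finset.range (b + 1), ∑ i ∈ Finset.range (min j (a + 1)),
        (p : ℝ) ^ (j - j / 2 - max 1 ((j - a + 1) / 2) - i / 2) := by
  rw [cellIndex₂, Finset.sum_sigma,
    Finset.sum_comm' (t' := Finset.range (b + 1)) (s' := fun j => Finset.range (min j (a + 1)))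
      (s := Finset.range (a + 1)) (t := fun i => Finset.Ioc i b) (f := fun i j => _)
      (by simp only [Finset.mem_range, Finset.mem_Ioc]; omega) |>.symm]
  refine Finset.sum_congr rfl fun i hi => ?_
  have hi := Finset.mem_range.1 hi
  rw [Finset.sum_sigma]
  refine Finset.sum_congr rfl fun j hj => ?_
  have hij := (Finset.mem_Ioc.1 hj).1
  dsimp only
  rw [Finset.sum_const, card_slopes hp (by omega) hij, nsmul_eq_mul]
  exact pow_mul_cellWeight hp.ne_zero hij.le (by omega) (by omega)

/-- `∑ q ^ (c - ⌊i / 2⌋)` over an even number of terms. -/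
theorem sum_pow_sub_half (q : ℝ) (c n : ℕ) :
    ∑ i ∈ Finset.range (2 * n), q ^ (c - i / 2) = 2 * ∑ t ∈ Finset.range n, q ^ (c - t) := by
  induction n with
  | zero => simp
  | succ n ih =>
    rw [show 2 * (n + 1) = 2 * n + 1 + 1 by ring, Finset.sum_range_succ, Finset.sum_range_succ, ih,
      Finset.sum_range_succ, show 2 * n / 2 = n by omega, show (2 * n + 1) / 2 = n by omega]
    ring

theorem sum_half_of_even (q : ℝ) (n : ℕ) :
    ∑ i ∈ Finset.range (2 * n + 2), q ^ (n - i / 2) = 2 * ∑ t ∈ Finset.range (n + 1), q ^ t := by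
  rw [show 2 * n + 2 = 2 * (n + 1) by ring, sum_pow_sub_half, ← Finset.sum_range_reflect]
  refine congrArg _ (Finset.sum_congr rfl fun t ht => ?_)
  have := Finset.mem_range.1 ht
  congr 1
  omega

theorem sum_half_of_odd (q : ℝ) (n : ℕ) :
    ∑ i ∈ Finset.range (2 * n + 1), q ^ (n - i / 2) =
      2 * ∑ t ∈ Finset.range (n + 1), q ^ t - 1 := by
  have h := sum_half_of_even q n
  rw [Finset.sum_range_succ, show (2 * n + 1) / 2 = n by omega, Nat.sub_self, pow_zero] at h
  linarith

theorem sum_half_succ (q : ℝ) (n : ℕ) :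
    ∑ i ∈ Finset.range (2 * n + 2), q ^ (n + 1 - i / 2) =
      2 * ∑ t ∈ Finset.range (n + 2), q ^ t - 2 := by
  have h := sum_half_of_odd q (n + 1)
  rw [show 2 * (n + 1) + 1 = 2 * n + 2 + 1 by ring, Finset.sum_range_succ,
    show (2 * n + 2) / 2 = n + 1 by omega, Nat.sub_self, pow_zero] at h
  linarith

/-- The contribution of the cells with second elementary divisor `p ^ j`, for `j ≤ a`. -/
noncomputable def column (q : ℝ) (j : ℕ) : ℝ :=
  ∑ i ∈ Finset.range (j + 1), q ^ (j - j / 2 - i / 2) +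
    ∑ i ∈ Finset.range j, q ^ (j - j / 2 - 1 - i / 2)

theorem column_even (q : ℝ) (n : ℕ) : column q (2 * n + 2) =
    2 * ∑ t ∈ Finset.range (n + 2), q ^ t - 1 + 2 * ∑ t ∈ Finset.range (n + 1), q ^ t := by
  rw [column, show 2 * n + 2 - (2 * n + 2) / 2 = n + 1 by omega, Nat.add_sub_cancel,
    sum_half_of_even, show 2 * n + 2 + 1 = 2 * (n + 1) + 1 by ring, sum_half_of_odd]

theorem column_odd (q : ℝ) (n : ℕ) : column q (2 * n + 1) =
    2 * ∑ t ∈ Finset.range (n + 2), q ^ t - 2 + (2 * ∑ t ∈ Finset.range (n + 1), q ^ t - 1) := by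
  rw [column, show 2 * n + 1 - (2 * n + 1) / 2 = n + 1 by omega, Nat.add_sub_cancel,
    sum_half_of_odd, sum_half_succ]

theorem sum_column (q : ℝ) (n : ℕ) : ∑ j ∈ Finset.range (2 * n + 1), column q j =
    1 + 4 * n + ∑ i ∈ Finset.Ico 1 (n + 1), 2 * (2 + 4 * (n : ℝ) - 4 * i) * q ^ i := by
  induction n with
  | zero => simp [column]
  | succ n ih =>
    have h1 : ∑ t ∈ Finset.range (n + 1), q ^ t = 1 + ∑ i ∈ Finset.Ico 1 (n + 1), q ^ i := by
      rw [Finset.range_eq_Ico, Finset.sum_eq_sum_Ico_succ_bot (Nat.succ_pos n), pow_zero]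
    have h2 : ∑ i ∈ Finset.Ico 1 (n + 1), 2 * (2 + 4 * ((n : ℝ) + 1) - 4 * i) * q ^ i =
        ∑ i ∈ Finset.Ico 1 (n + 1), 2 * (2 + 4 * (n : ℝ) - 4 * i) * q ^ i +
          8 * ∑ i ∈ Finset.Ico 1 (n + 1), q ^ i := by
      rw [Finset.mul_sum, ← Finset.sum_add_distrib]
      exact Finset.sum_congr rfl fun i _ => by ring
    rw [show 2 * (n + 1) + 1 = 2 * n + 1 + 1 + 1 by ring, Finset.sum_range_succ,
      Finset.sum_range_succ, ih, show 2 * n + 1 + 1 = 2 * n + 2 by ring, column_even, column_odd,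
      Finset.sum_Ico_succ_top (show 1 ≤ n + 1 by omega), Finset.sum_range_succ _ (n + 1)]
    push_cast
    rw [h2, h1]
    ring

/-- The sum of the weights of all cells. -/
noncomputable def totalWeight (p a b : ℕ) : ℝ :=
  ∑ τ ∈ cellIndex₁ p a, cellWeight p τ.1 τ.2.1 + ∑ τ ∈ cellIndex₂ p a b, cellWeight p τ.1 τ.2.1

/-- For `j ≤ a` both families of cells contribute and the only constraint on a swapped slope is `p ∣
s`. For `j > a` only swapped cells remain, with `i ≤ a`. -/
theorem totalWeight_eq {p : ℕ} (hp : p.Prime) {a b : ℕ} (hab : a ≤ b) :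
    totalWeight p a b = ∑ j ∈ Finset.range (a + 1), column p j +
      ∑ j ∈ Finset.Ico (a + 1) (b + 1), ∑ i ∈ Finset.range (a + 1),
        (p : ℝ) ^ (j - j / 2 - (j - a + 1) / 2 - i / 2) := by
  rw [totalWeight, sum_cellIndex₁ hp.ne_zero, sum_cellIndex₂ hp,
    ← Finset.sum_range_add_sum_Ico _ (show a + 1 ≤ b + 1 by omega), ← add_assoc,
    ← Finset.sum_add_distrib]
  congr 1
  · refine Finset.sum_congr rfl fun j hj => ?_
    have := Finset.mem_range.1 hj
    rw [column, min_eq_left (by omega), max_eq_left (by omega)]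
  · refine Finset.sum_congr rfl fun j hj => ?_
    have := Finset.mem_Ico.1 hj
    rw [min_eq_right (by omega), max_eq_right (by omega)]

theorem totalWeight_even {p : ℕ} (hp : p.Prime) {n b : ℕ} (hab : 2 * n ≤ b) :
    totalWeight p (2 * n) b = 1 + 2 * n + b +
      ∑ i ∈ Finset.Ico 1 (n + 1), 2 * (2 + 2 * (n : ℝ) + b - 4 * i) * (p : ℝ) ^ i := by
  rw [totalWeight_eq hp hab, sum_column]
  have h : ∀ j ∈ Finset.Ico (2 * n + 1) (b + 1), ∑ i ∈ Finset.range (2 * n + 1),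
      (p : ℝ) ^ (j - j / 2 - (j - 2 * n + 1) / 2 - i / 2) =
      1 + 2 * ∑ i ∈ Finset.Ico 1 (n + 1), (p : ℝ) ^ i := by
    intro j hj
    have := Finset.mem_Ico.1 hj
    -- For even `a` the exponent does not depend on `j`, so all columns beyond `a` have the same
    -- sum.
    rw [show j - j / 2 - (j - 2 * n + 1) / 2 = n by omega, sum_half_of_odd, Finset.range_eq_Ico,
      Finset.sum_eq_sum_Ico_succ_bot (Nat.succ_pos n), pow_zero]
    ring
  have h2 : ∑ i ∈ Finset.Ico 1 (n + 1), 2 * (2 + 2 * (n : ℝ) + b - 4 * i) * (p : ℝ) ^ i =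
      ∑ i ∈ Finset.Ico 1 (n + 1), 2 * (2 + 4 * (n : ℝ) - 4 * i) * (p : ℝ) ^ i +
        (2 * b - 4 * n) * ∑ i ∈ Finset.Ico 1 (n + 1), (p : ℝ) ^ i := by
    rw [Finset.mul_sum, ← Finset.sum_add_distrib]
    exact Finset.sum_congr rfl fun i _ => by ring
  obtain ⟨d, rfl⟩ := Nat.exists_eq_add_of_le hab
  rw [Finset.sum_congr rfl h, Finset.sum_const, Nat.card_Ico, h2, nsmul_eq_mul,
    show 2 * n + d + 1 - (2 * n + 1) = d by omega]
  push_cast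
  ring

/-- For odd `a` the columns beyond `a` alternate between two values with the parity of `j`. As `b`
is even, the induction adds them two at a time, starting from `b = a + 1`. -/
theorem totalWeight_odd {p : ℕ} (hp : p.Prime) (n d : ℕ) :
    totalWeight p (2 * n + 1) (2 * n + 2 + 2 * d) = 1 + (2 * n + 1) + (2 * n + 2 + 2 * d) +
      ∑ i ∈ Finset.Ico 1 (n + 1),
        2 * (2 + (2 * (n : ℝ) + 1) + (2 * n + 2 + 2 * d) - 4 * i) * (p : ℝ) ^ i +
      (2 * d + 2) * (p : ℝ) ^ (n + 1) := by
  have h1 : ∑ t ∈ Finset.range (n + 1), (p : ℝ) ^ t =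
      1 + ∑ i ∈ Finset.Ico 1 (n + 1), (p : ℝ) ^ i := by
    rw [Finset.range_eq_Ico, Finset.sum_eq_sum_Ico_succ_bot (Nat.succ_pos n), pow_zero]
  have heven : ∀ d, ∑ i ∈ Finset.range (2 * n + 1 + 1), (p : ℝ) ^ (2 * n + 2 + 2 * d -
      (2 * n + 2 + 2 * d) / 2 - (2 * n + 2 + 2 * d - (2 * n + 1) + 1) / 2 - i / 2) =
      2 * ∑ t ∈ Finset.range (n + 1), (p : ℝ) ^ t := by
    intro d
    rw [show 2 * n + 2 + 2 * d - (2 * n + 2 + 2 * d) / 2 - (2 * n + 2 + 2 * d - (2 * n + 1) + 1) / 2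
      = n by omega, sum_half_of_even]
  have hodd : ∀ d, ∑ i ∈ Finset.range (2 * n + 1 + 1), (p : ℝ) ^ (2 * n + 2 + 2 * d + 1 -
      (2 * n + 2 + 2 * d + 1) / 2 - (2 * n + 2 + 2 * d + 1 - (2 * n + 1) + 1) / 2 - i / 2) =
      2 * ∑ t ∈ Finset.range (n + 2), (p : ℝ) ^ t - 2 := by
    intro d
    rw [show 2 * n + 2 + 2 * d + 1 - (2 * n + 2 + 2 * d + 1) / 2 -
      (2 * n + 2 + 2 * d + 1 - (2 * n + 1) + 1) / 2 = n + 1 by omega, sum_half_succ]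
  induction d with
  | zero =>
    rw [totalWeight_eq hp (by omega), Finset.sum_range_succ, sum_column, column_odd, mul_zero,
      add_zero, Finset.sum_Ico_succ_top (show 2 * n + 1 + 1 ≤ 2 * n + 2 by omega), Finset.Ico_self, Finset.sum_empty]
    have := heven 0
    rw [mul_zero, add_zero] at this
    have h2 : ∑ i ∈ Finset.Ico 1 (n + 1),
        2 * (2 + (2 * (n : ℝ) + 1) + (2 * n + 2 + 2 * (0 : ℕ)) - 4 * i) * (p : ℝ) ^ i =
        ∑ i ∈ Finset.Ico 1 (n + 1), 2 * (2 + 4 * (n : ℝ) - 4 * i) * (p : ℝ) ^ i +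
          6 * ∑ i ∈ Finset.Ico 1 (n + 1), (p : ℝ) ^ i := by
      rw [Finset.mul_sum, ← Finset.sum_add_distrib]
      exact Finset.sum_congr rfl fun i _ => by push_cast; ring
    rw [this, h2, Finset.sum_range_succ _ (n + 1), h1]
    push_cast
    ring
  | succ d ih =>
    rw [totalWeight_eq hp (by omega)] at ih ⊢
    have h2 : ∑ i ∈ Finset.Ico 1 (n + 1),
        2 * (2 + (2 * (n : ℝ) + 1) + (2 * n + 2 + 2 * (d + 1 : ℕ)) - 4 * i) * (p : ℝ) ^ i =
        ∑ i ∈ Finset.Ico 1 (n + 1),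
        2 * (2 + (2 * (n : ℝ) + 1) + (2 * n + 2 + 2 * d) - 4 * i) * (p : ℝ) ^ i +
          4 * ∑ i ∈ Finset.Ico 1 (n + 1), (p : ℝ) ^ i := by
      rw [Finset.mul_sum, ← Finset.sum_add_distrib]
      exact Finset.sum_congr rfl fun i _ => by push_cast; ring
    rw [show 2 * n + 2 + 2 * (d + 1) + 1 = 2 * n + 2 + 2 * d + 1 + 1 + 1 by ring,
      Finset.sum_Ico_succ_top (by omega), Finset.sum_Ico_succ_top (by omega), hodd,
      show 2 * n + 2 + 2 * d + 1 + 1 = 2 * n + 2 + 2 * (d + 1) by ring, heven, ← add_assoc,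
      ← add_assoc, ih, h2, Finset.sum_range_succ _ (n + 1), h1]
    push_cast
    ring

theorem totalWeight_eq_grossKeatingNumber {p : ℕ} (hp : p.Prime) {a b : ℕ} (ha : 1 ≤ a)
    (hab : a ≤ b) (hodd : ¬ (Odd a ∧ Odd b)) :
    totalWeight p a b = grossKeatingNumber p 1 a b := by
  rw [grossKeatingNumber]
  rcases Nat.even_or_odd' a with ⟨n, rfl | rfl⟩
  · rw [if_neg (by unfold Nat.ModEq; omega), totalWeight_even hp hab,
      show (1 + 2 * n + 1) / 2 = n + 1 by omega]
    simp
    refine Finset.sum_congr rfl fun i _ => by ring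
  · have hb : Even b := by
      rw [← Nat.not_odd_iff_even]
      exact fun h => hodd ⟨⟨n, rfl⟩, h⟩
    obtain ⟨c, rfl⟩ := hb
    obtain ⟨d, hd⟩ := Nat.exists_eq_add_of_le (show n + 1 ≤ c by omega)
    have hc : c + c = 2 * n + 2 + 2 * d := by omega
    rw [hc, if_pos (by unfold Nat.ModEq; omega), totalWeight_odd hp,
      show (1 + (2 * n + 1)) / 2 = n + 1 by omega]
    have h : ∀ x y z x' y' z' : ℝ, x = x' → y = y' → z = z' → x + y + z = x' + y' + z' := by
      rintro _ _ _ _ _ _ rfl rfl rfl; rfl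
    apply h
    · simp
    · exact Finset.sum_congr rfl fun i _ => by push_cast; ring
    · push_cast; ring

/-- For `a = 0` the sum is `1 + b`. The order `1` of `N` now stands in the middle of the invariants,
or last if also `b = 0`, which needs the other branch of the formula. -/
theorem totalWeight_zero {p : ℕ} (hp : p.Prime) (b : ℕ) :
    totalWeight p 0 b = grossKeatingNumber p 0 1 b := by
  have h := totalWeight_even hp (n := 0) (Nat.zero_le b)
  rw [mul_zero] at h
  rw [h, grossKeatingNumber, if_neg (by unfold Nat.ModEq; omega)]
  simp

theorem totalWeight_zero_zero {p : ℕ} (hp : p.Prime) :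
    totalWeight p 0 0 = grossKeatingNumber p 0 0 1 := by
  have h := totalWeight_even hp (n := 0) (le_refl 0)
  rw [mul_zero] at h
  rw [h, grossKeatingNumber, if_pos (by unfold Nat.ModEq; omega)]
  norm_num

end Sums

/-! ### The density polynomial and the invariants of `diag(N, T)`. -/

section Main

variable {p : ℕ} [Fact p.Prime]

/-- The Gross–Keating invariants of `diag(N, T)`, for `T ≅ diag(t₁, t₂)`. -/
theorem isGrossKeating_diagBlock (hp : p ≠ 2) {N : ℕ} {T G G' : Matrix (Fin 2) (Fin 2) ℤ_[p]}
    {t : Fin 3 → ℤ_[p]} (h : G * G' = 1) (h' : G' * G = 1)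
    (hT : T = G.transpose * !![t 1, 0; 0, t 2] * G) (hN : (N : ℤ_[p]) = t 0)
    {u : Fin 3 → ℤ_[p]} {c : Fin 3 → ℕ} (hu : ∀ i, IsUnit (u i)) (ht : ∀ i, t i = u i * p ^ c i)
    (σ : Equiv.Perm (Fin 3)) (hc : Monotone (c ∘ σ)) :
    IsGrossKeating (diagBlock N T) (c ∘ σ) := by
  have key : ∀ A A' : Matrix (Fin 2) (Fin 2) ℤ_[p], A * A' = 1 →
      !![1, 0, 0; 0, A 0 0, A 0 1; 0, A 1 0, A 1 1] *
      !![1, 0, 0; 0, A' 0 0, A' 0 1; 0, A' 1 0, A' 1 1] = 1 := by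
    intro A A' hA
    have g : ∀ i j, (A * A') i j = (1 : Matrix (Fin 2) (Fin 2) ℤ_[p]) i j := fun i j => by rw [hA]
    simp only [Matrix.mul_apply, Fin.sum_univ_two, Matrix.one_apply] at g
    have g00 := g 0 0
    have g01 := g 0 1
    have g10 := g 1 0
    have g11 := g 1 1
    simp at g00 g01 g10 g11
    ext i j
    fin_cases i <;> fin_cases j <;>
      simp [Matrix.mul_apply, Fin.sum_univ_three, g00, g01, g10, g11]
  set E : Matrix (Fin 3) (Fin 3) ℤ_[p] := !![1, 0, 0; 0, G 0 0, G 0 1; 0, G 1 0, G 1 1] with hE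
  set E' : Matrix (Fin 3) (Fin 3) ℤ_[p] := !![1, 0, 0; 0, G' 0 0, G' 0 1; 0, G' 1 0, G' 1 1] with hE'
  have hB : diagBlock N T = E.transpose * Matrix.diagonal t * E := by
    rw [diagBlock, hT, hN, hE]
    ext i j
    fin_cases i <;> fin_cases j <;>
      simp [Matrix.mul_apply, Fin.sum_univ_three, Fin.sum_univ_two, Matrix.diagonal]
  refine isGrossKeating_of_diagonal hp (G := E.submatrix σ id) (G' := E'.submatrix id σ)
    (d := t ∘ σ) (u := u ∘ σ) ?_ ?_ (fun i => hu _) (fun i => ht _) hc ?_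
  · rw [← Matrix.submatrix_mul _ _ _ _ _ Function.bijective_id, key _ _ h]
    exact Matrix.submatrix_one_equiv σ
  · rw [Matrix.submatrix_mul_equiv, key _ _ h', Matrix.submatrix_id_id]
  · rw [hB, ← Matrix.submatrix_diagonal_equiv, Matrix.transpose_submatrix,
      Matrix.submatrix_mul_equiv, Matrix.submatrix_mul_equiv, Matrix.submatrix_id_id]

theorem monotone_vec {x y z : ℕ} (h : x ≤ y) (h' : y ≤ z) : Monotone ![x, y, z] := by
  rw [Fin.monotone_iff_le_succ]
  intro i
  fin_cases i
  · exact h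
  · exact h'

/-- The local density polynomial. -/
noncomputable def densityPolynomial (p a b : ℕ) : ℝ[X] :=
  (1 - X) * ((1 - C (p : ℝ)⁻¹ * X) *
    (∑ τ ∈ cellIndex₁ p a, C (cellWeight p τ.1 τ.2.1) * X ^ (τ.1 + τ.2.1) +
      ∑ τ ∈ cellIndex₂ p a b, C (cellWeight p τ.1 τ.2.1) * X ^ (τ.1 + τ.2.1)))

theorem derivative_densityPolynomial (p a b : ℕ) (hp : 1 < p) :
    (p : ℝ) / (1 - p) * (derivative (densityPolynomial p a b)).eval 1 = totalWeight p a b := by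
  have h0 : (p : ℝ) ≠ 0 := by positivity
  have h1 : (1 : ℝ) - p ≠ 0 := by
    have : (1 : ℝ) < p := by exact_mod_cast hp
    linarith
  rw [densityPolynomial, derivative_mul, eval_add, eval_mul, eval_mul]
  simp only [derivative_sub, derivative_one, derivative_X, eval_sub, eval_one, eval_zero, eval_X,
    sub_self, zero_mul, add_zero, eval_mul, eval_C, eval_add, eval_finsetSum, eval_pow, one_pow,
    mul_one]
  rw [← totalWeight]
  field_simp
  ring

theorem isRepDensityPolynomial (hp : p ≠ 2) {N : ℕ} {n u₁ u₂ : ℤ_[p]} {a b : ℕ}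
    {T G G' : Matrix (Fin 2) (Fin 2) ℤ_[p]}
    (h : Anisotropic (N : ℤ_[p]) (u₁ * p ^ a) (u₂ * p ^ b)) (hN : N ≠ 0) (hn : IsUnit n)
    (hc : (N : ℤ_[p]) = n * p) (hu₁ : IsUnit u₁) (hu₂ : IsUnit u₂) (hab : a ≤ b)
    (hG : G * G' = 1) (hG' : G' * G = 1)
    (hT : T = G.transpose * !![u₁ * (p : ℤ_[p]) ^ a, 0; 0, u₂ * (p : ℤ_[p]) ^ b] * G) :
    IsRepDensityPolynomial (levelForm p N) (levelLattice p N) T (densityPolynomial p a b) := by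
  intro r
  refine isRepDensity_of_eventually hp hN r hG hG' rfl hT (K := b + 1) fun k hk => ?_
  have := finite_quotient p k
  rw [dens_solutions (isTruncation_quotient p k) hp h hn hc hu₁ hu₂ hab hk]
  have h0 : (p : ℝ) ≠ 0 := by exact_mod_cast (Fact.out : p.Prime).ne_zero
  -- This is the variable `X = p ^ (-r)`; accordingly `(p ^ (r + 1))⁻¹` is `X / p`.
  have e : (p : ℝ) * ((p : ℝ) ^ (r + 1))⁻¹ = ((p : ℝ)⁻¹) ^ r := by
    rw [inv_pow]
    field_simp
    ring
  rw [e, densityPolynomial]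
  simp only [eval_mul, eval_sub, eval_one, eval_X, eval_C, eval_add, eval_finsetSum, eval_pow]
  rw [← inv_pow, pow_succ']
  ring

end Main

end LocalDensity

open LocalDensity in
theorem mainTheorem4 (p : ℕ) [Fact p.Prime] (N : ℕ) (hN_odd : Odd N) (hN_sqfree : Squarefree N)
    (hpN : p ∣ N) (T : Matrix (Fin 2) (Fin 2) ℤ_[p]) (hT : T.IsSymm)
    (hrep : ¬ LocalDensity.Represents (LocalDensity.levelForm p N)
      (T.map fun t => (t : ℚ_[p]))) :
    ∃ (P : Polynomial ℝ) (a : Fin 3 → ℕ),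
      LocalDensity.IsRepDensityPolynomial (LocalDensity.levelForm p N)
        (LocalDensity.levelLattice p N) T P ∧
      LocalDensity.IsGrossKeating (LocalDensity.diagBlock N T) a ∧
      (p : ℝ) / (1 - (p : ℝ)) * (Polynomial.derivative P).eval 1 =
        LocalDensity.grossKeatingNumber p (a 0) (a 1) (a 2) := by
  have hprime : p.Prime := Fact.out
  have hN : N ≠ 0 := hN_sqfree.ne_zero
  have hp : p ≠ 2 := by
    rintro rfl
    exact (Nat.not_even_iff_odd.2 hN_odd) (even_iff_two_dvd.2 hpN)
  obtain ⟨n, hn⟩ := hpN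
  have hcN : (N : ℤ_[p]) = (n : ℤ_[p]) * p := by rw [hn]; push_cast; ring
  have hnu : IsUnit (n : ℤ_[p]) := by
    by_contra h
    rw [not_isUnit_iff_dvd] at h
    have h1 := (PadicInt.pow_p_dvd_int_iff (p := p) 1 n).1 (by simpa using h)
    have h2 : p ∣ n := by exact_mod_cast (by simpa using h1 : (p : ℤ) ∣ n)
    -- Squarefreeness makes the order of `N` at `p` exactly one.
    exact hprime.not_isUnit (hN_sqfree p (hn ▸ mul_dvd_mul_left p h2))
  obtain ⟨G, G', t₁, t₂, hG, hG', hTG, ht⟩ := exists_diagonal hp hT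
  have han := anisotropic_of_not_represents hN hG hTG hrep
  have ht₁ : t₁ ≠ 0 := by
    rintro rfl
    exact one_ne_zero (han 0 1 0 (by ring)).2.1
  have ht₂ : t₂ ≠ 0 := by
    rintro rfl
    exact one_ne_zero (han 0 0 1 (by ring)).2.2
  obtain ⟨a, u₁, hu₁, e₁⟩ : ∃ (a : ℕ) (u : ℤ_[p]), IsUnit u ∧ t₁ = u * p ^ a :=
    ⟨_, _, Units.isUnit _, PadicInt.unitCoeff_spec ht₁⟩
  obtain ⟨b, u₂, hu₂, e₂⟩ : ∃ (b : ℕ) (u : ℤ_[p]), IsUnit u ∧ t₂ = u * p ^ b :=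
    ⟨_, _, Units.isUnit _, PadicInt.unitCoeff_spec ht₂⟩
  subst e₁ e₂
  have hab : a ≤ b := (pow_dvd_unit_mul_pow hu₂).1 ((Dvd.intro_left u₁ rfl).trans ht)
  have hodd : ¬ (Odd a ∧ Odd b) := by
    rintro ⟨⟨α, rfl⟩, ⟨β, rfl⟩⟩
    exact han.not_odd hp hnu hu₁ hu₂ hcN rfl rfl
  have hP := isRepDensityPolynomial hp han hN hnu hcN hu₁ hu₂ hab hG hG' hTG
  have hder := derivative_densityPolynomial p a b hprime.one_lt
  have hGK := isGrossKeating_diagBlock hp (N := N) (T := T)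
    (t := ![(N : ℤ_[p]), u₁ * p ^ a, u₂ * p ^ b]) hG hG' hTG rfl
    (u := ![(n : ℤ_[p]), u₁, u₂]) (c := ![1, a, b])
    (by intro i; fin_cases i <;> assumption)
    (by intro i; fin_cases i <;> simp [hcN])
  -- The orders `1, a, b` must be sorted; the position of `1` depends on whether `a` and `b` vanish.
  rcases Nat.eq_zero_or_pos a with rfl | ha
  · rcases Nat.eq_zero_or_pos b with rfl | hb
    · have e : (![1, 0, 0] : Fin 3 → ℕ) ∘ finRotate 3 = ![0, 0, 1] := by decide
      refine ⟨_, _, hP, hGK (finRotate 3) (e ▸ monotone_vec le_rfl zero_le_one), ?_⟩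
      rw [hder, totalWeight_zero_zero hprime, e]
      rfl
    · have e : (![1, 0, b] : Fin 3 → ℕ) ∘ Equiv.swap 0 1 = ![0, 1, b] := by
        ext i
        fin_cases i <;> rfl
      refine ⟨_, _, hP, hGK (Equiv.swap 0 1) (e ▸ monotone_vec zero_le_one hb), ?_⟩
      rw [hder, totalWeight_zero hprime b, e]
      rfl
  · refine ⟨_, _, hP, hGK (Equiv.refl _) (monotone_vec ha hab), ?_⟩
    rw [hder, totalWeight_eq_grossKeatingNumber hprime ha hab hodd]
    rfl
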